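/- Let $\rho>0$, let $\Lambda\ge 0$ be an integer, and let $X_1,\dots,X_\Lambda$ be independent homogeneous Poisson point processes of intensity $\rho$ on the whole plane $\mathbb{R}^2$ (so that there are no boundary effects). Each $X_\lambda$ is the vertex set of a Delaunay triangulation, whose triangles are those with vertices in $X_\lambda$ and no point of $X_\lambda$ inside the circumscribed circle. Let $B$ be the random operator whose columns $\chi_p$ are the indicator functions of all triangles $p$ of all $\Lambda$ triangulations, so that $(B^{\mathsf T}x)_p=\langle \chi_p,x\rangle$. For an image $x$, put $q=B^{\mathsf T}x$ and $\hat x=(B^{\mathsf T})^\dagger q$, where $(B^{\mathsf T})^\dagger q$ is the minimal-norm least-squares solution of $B^{\mathsf T}x'=q$ (the Moore–Penrose pseudoinverse). (a) Continuous images, $x\in L^2(\mathbb{R}^2)$. There is a kernel $\tilde\kappa:\mathbb{R}^2\to\mathbb{R}$ such that for every $x\in L^2(\mathbb{R}^2)$ the random element $\hat x$ of $L^2(\mathbb{R}^2)$ is (Bochner) integrable, the integral $(x*\tilde\kappa)(u)=\int x(v)\,\tilde\kappa(u-v)\,dv$ converges absolutely for every $u\in\mathbb{R}^2$, and $\mathbb{E}\,\hat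 x=x*\tilde\kappa$ almost everywhere. Furthermore $\tilde\kappa$ is isotropic: $\tilde\kappa(w)$ depends only on $\|w\|$. (b) Discrete images, $x\in\ell^2(\mathbb{Z}^2)$, where the pixels are the points of $\mathbb{Z}^2\subset\mathbb{R}^2$ and $\chi_p$ is the indicator function of the set of pixels in the triangle $p$. There is a kernel $\tilde\kappa:\mathbb{Z}^2\to\mathbb{R}$ such that for every $x\in\ell^2(\mathbb{Z}^2)$ the random element $\hat x$ of $\ell^2(\mathbb{Z}^2)$ is (Bochner) integrable and $(\mathbb{E}\,\hat x)(u)=\sum_{v\in\mathbb{Z}^2}x(v)\,\tilde\kappa(u-v)$ for every $u\in\mathbb{Z}^2$, with an absolutely convergent sum. Furthermore $\tilde\kappa$ is isotropic as far as the pixel grid allows: $\tilde\kappa(Rw)=\tilde\kappa(w)$ for every $w\in\mathbb{Z}^2$ and every rotation or reflection $R$ of the plane about the origin that maps $\mathbb{Z}^2$ to itself. -/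

import Mathlib

open MeasureTheory ProbabilityTheory
open scoped ENNReal NNReal

noncomputable section

namespace RandomMesh

/-- The plane with its Euclidean norm. -/
abbrev Plane := EuclideanSpace ℝ (Fin 2)

section PointProcess

/-- The usual sigma-algebra on point configurations in the plane: the smallest one for which
the number of points in every Borel set is a measurable function of the configuration. -/
@[reducible]
def configurations : MeasurableSpace (Set Plane) :=
  ⨆ (A : Set Plane) (_ : MeasurableSet A),
    MeasurableSpace.comap (fun S : Set Plane => (S ∩ A).encard) inferInstance

/-- `X` is a homogeneous (uniform) Poisson point process in the plane with `ρ` points per unit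
area on average: the number of points in a Borel set of finite area `a` has the Poisson
distribution with mean `ρ * a`, and the numbers of points in disjoint Borel sets are
independent. -/
structure IsPoissonProcess {Ω : Type*} [MeasurableSpace Ω] (P : Measure Ω) (ρ : ℝ≥0)
    (X : Ω → Set Plane) : Prop where
  measurable : Measurable[_, configurations] X
  count_law : ∀ A : Set Plane, MeasurableSet A → volume A ≠ ∞ →
    P.map (fun ω => (X ω ∩ A).encard) =
      (poissonMeasure (ρ * (volume A).toNNReal)).map (fun n : ℕ => (n : ℕ∞))
  count_indep : ∀ (n : ℕ) (A : Fin n → Set Plane), (∀ i, MeasurableSet (A i)) →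
    Pairwise (fun i j => Disjoint (A i) (A j)) →
    iIndepFun (fun i ω => (X ω ∩ A i).encard) P

/-- The point processes `X l` are independent as random point configurations. -/
def IndependentProcesses {Ω : Type*} [MeasurableSpace Ω] (P : Measure Ω) {L : ℕ}
    (X : Fin L → Ω → Set Plane) : Prop :=
  iIndepFun (m := fun _ => configurations) X P

end PointProcess

section Delaunay

/-- The Delaunay triangles with vertices in the point set `S`: the sets `t` of three points
of `S` that lie on a circle (so that they are not collinear) whose open disc contains no
point of `S`. -/
def delaunay (S : Set Plane) : Set (Finset Plane) :=
  {t | (t : Set Plane) ⊆ S ∧ t.card = 3 ∧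
    ∃ (c : Plane) (r : ℝ), (∀ p ∈ t, dist p c = r) ∧ ∀ p ∈ S, r ≤ dist p c}

/-- The (closed, filled) triangle with the given vertices. -/
def triangle (t : Finset Plane) : Set Plane := convexHull ℝ (t : Set Plane)

theorem isCompact_triangle (t : Finset Plane) : IsCompact (triangle t) :=
  t.finite_toSet.isCompact_convexHull ℝ

/-- All triangles of the `L` Delaunay meshes with vertex sets `S 0, …, S (L - 1)`; these
index the columns of the stacked matrix `B`. -/
abbrev Columns {L : ℕ} (S : Fin L → Set Plane) := Σ l : Fin L, delaunay (S l)

end Delaunay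

section PseudoInverse

variable {H : Type*} [NormedAddCommGroup H] [InnerProductSpace ℝ H] {ι : Type*}

/-- `Bᵀ x`, where `B` is the operator with columns `b p`: the vector of all inner products
of `x` with the columns. -/
def transposeApply (b : ι → H) (x : H) : ι → ℝ := fun p => inner ℝ (b p) x

/-- The squared norm of the residual `q - Bᵀ x`. -/
def residualSq (b : ι → H) (q : ι → ℝ) (x : H) : ℝ≥0∞ :=
  ∑' p, ENNReal.ofReal ((q p - transposeApply b x p) ^ 2)

/-- `x` is a least-squares solution of `Bᵀ x = q`. -/
def IsLeastSquares (b : ι → H) (q : ι → ℝ) (x : H) : Prop :=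
  ∀ y, residualSq b q x ≤ residualSq b q y

/-- `x` is a least-squares solution of `Bᵀ x = q` of minimal norm. -/
def IsPinvSolution (b : ι → H) (q : ι → ℝ) (x : H) : Prop :=
  IsLeastSquares b q x ∧ ∀ y, IsLeastSquares b q y → ‖x‖ ≤ ‖y‖

open Classical in
/-- `(Bᵀ)† q`, the Moore-Penrose pseudoinverse of `Bᵀ` applied to `q`: the least-squares
solution of `Bᵀ x = q` of minimal norm. -/
def pinvTranspose (b : ι → H) (q : ι → ℝ) : H :=
  if h : ∃ x, IsPinvSolution b q x then h.choose else 0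

end PseudoInverse

section Continuous

/-- Images on the whole plane. -/
abbrev Image := Lp ℝ 2 (volume : Measure Plane)

/-- The column of `B` that belongs to a triangle: its indicator function. -/
def column {L : ℕ} (S : Fin L → Set Plane) (p : Columns S) : Image :=
  indicatorConstLp 2 (isCompact_triangle p.2.1).measurableSet
    (isCompact_triangle p.2.1).measure_lt_top.ne (1 : ℝ)

/-- The reconstruction `(Bᵀ)† q` from the data `q = Bᵀ x`. -/
def reconstruction {L : ℕ} (S : Fin L → Set Plane) (x : Image) : Image :=
  pinvTranspose (column S) (transposeApply (column S) x)

end Continuous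

section Discrete

/-- Images on the infinite grid of pixels. -/
abbrev PixelImage := lp (fun _ : ℤ × ℤ => ℝ) 2

/-- The position of a pixel in the plane. -/
def pixel (u : ℤ × ℤ) : Plane := !₂[(u.1 : ℝ), (u.2 : ℝ)]

theorem finite_pixels (t : Finset Plane) : (pixel ⁻¹' triangle t).Finite := by
  obtain ⟨R, hR⟩ := (isCompact_triangle t).isBounded.exists_norm_le
  refine (((Set.finite_Icc (-⌈R⌉) ⌈R⌉).prod (Set.finite_Icc (-⌈R⌉) ⌈R⌉))).subset ?_
  intro u hu
  have h := hR _ hu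
  have h0 : |(u.1 : ℝ)| ≤ ⌈R⌉ := by
    simpa [pixel] using ((PiLp.norm_apply_le (pixel u) 0).trans h).trans (Int.le_ceil R)
  have h1 : |(u.2 : ℝ)| ≤ ⌈R⌉ := by
    simpa [pixel] using ((PiLp.norm_apply_le (pixel u) 1).trans h).trans (Int.le_ceil R)
  rw [abs_le] at h0 h1
  exact ⟨⟨by exact_mod_cast h0.1, by exact_mod_cast h0.2⟩,
    ⟨by exact_mod_cast h1.1, by exact_mod_cast h1.2⟩⟩

/-- The column of `B` that belongs to a triangle, for pixel images: the indicator function of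
the set of pixels in the triangle. -/
def pixelColumn {L : ℕ} (S : Fin L → Set Plane) (p : Columns S) : PixelImage :=
  ⟨(pixel ⁻¹' triangle p.2.1).indicator (fun _ => (1 : ℝ)),
    (memℓp_zero ((finite_pixels p.2.1).subset fun u hu => by
      by_contra h
      exact hu (Set.indicator_of_notMem h _))).of_exponent_ge (zero_le (a := (2 : ℝ≥0∞)))⟩

/-- The reconstruction `(Bᵀ)† q` from the data `q = Bᵀ x`, for pixel images. -/
def pixelReconstruction {L : ℕ} (S : Fin L → Set Plane) (x : PixelImage) : PixelImage :=
  pinvTranspose (pixelColumn S) (transposeApply (pixelColumn S) x)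

end Discrete

end RandomMesh

end

/-! The data `q = Bᵀ x` are consistent, so the least-squares solutions are the images with the same
inner products against all columns as `x`, and the one of minimal norm is the orthogonal projection
of `x` to the closed span of the columns. Hence `𝔼 x̂ = T x`, where `T` is the mean of random
orthogonal projections: it is self-adjoint with `0 ≤ T ≤ 1`, so `T² ≤ T`. The law of a Poisson
process is invariant under isometries of the plane (it is determined by the void probabilities,
which depend on area only) and the Delaunay construction is equivariant. Therefore `T` commutes with
every isometry of the plane, and in the discrete case with those that preserve the pixel grid.

For pixels this is enough: the kernel is `T δ₀`, by self-adjointness and translation invariance.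

On `L²` of the plane invariance alone does not give a kernel, since the identity is also invariant.
The extra input is a trace bound. An orthonormal family supported in a fixed disc has trace against
a projection at most the number of columns meeting that disc (`sum_norm_sq_spanProj_le`), and the
expected number of Delaunay triangles meeting a disc is finite (`exists_bound_centralTriangles`),
because a large triangle there forces a large empty square, which is exponentially unlikely. Applied
to `(n + 1)²` translates of one small disc, which contribute equally, the bound shows that `T` of
the disc indicator divided by its area stays bounded in `L²` as the radius shrinks
(`norm_apply_disc_le`). A weak cluster point `k` of these images is the kernel: pairing it with a
translate of `x` gives the limit of averages of `T x` over shrinking discs, which is `T x` almost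
everywhere by Lebesgue differentiation (`exists_radial_kernel`).

Bochner integrability requires that the projection depend measurably on the configurations; for this
the triangles are indexed by triples from a countable basis that isolate their vertices. -/

open Filter Topology

namespace RandomMesh

/-! ### Pseudoinverse as orthogonal projection, and the trace bound -/

section Hilbert

variable {H : Type*} [NormedAddCommGroup H] [InnerProductSpace ℝ H] {ι : Type*}

/-- The closed linear span of a family of vectors. -/
def closedSpan (b : ι → H) : Submodule ℝ H := (Submodule.span ℝ (Set.range b)).topologicalClosure

theorem mem_closedSpan (b : ι → H) (i : ι) : b i ∈ closedSpan b :=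
  Submodule.le_topologicalClosure _ (Submodule.subset_span ⟨i, rfl⟩)

theorem closedSpan_le {b : ι → H} {V : Submodule ℝ H} (hV : IsClosed (V : Set H))
    (h : ∀ i, b i ∈ V) : closedSpan b ≤ V :=
  Submodule.topologicalClosure_minimal _
    (Submodule.span_le.2 (by rintro _ ⟨i, rfl⟩; exact h i)) hV

theorem closedSpan_isClosed (b : ι → H) : IsClosed (closedSpan b : Set H) :=
  Submodule.isClosed_topologicalClosure _

theorem inner_eq_zero_of_closedSpan {b : ι → H} {x y : H} (h : ∀ i, inner ℝ (b i) x = 0)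
    (hy : y ∈ closedSpan b) : inner ℝ y x = 0 := by
  have h1 : closedSpan b ≤ (Submodule.span ℝ {x})ᗮ := by
    refine closedSpan_le (Submodule.isClosed_orthogonal _) fun i => ?_
    rw [Submodule.mem_orthogonal_singleton_iff_inner_left]
    exact h i
  exact Submodule.mem_orthogonal_singleton_iff_inner_left.1 (h1 hy)

theorem closedSpan_congr {κ : Type*} {b : ι → H} {c : κ → H} (h : ∀ i, b i ∈ closedSpan c)
    (h' : ∀ j, c j ∈ closedSpan b) : closedSpan b = closedSpan c :=
  le_antisymm (closedSpan_le (closedSpan_isClosed c) h) (closedSpan_le (closedSpan_isClosed b) h')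

theorem residualSq_transposeApply_self (b : ι → H) (x : H) :
    residualSq b (transposeApply b x) x = 0 := by
  simp [residualSq]

variable [CompleteSpace H]

instance (b : ι → H) : (closedSpan b).HasOrthogonalProjection := by
  have : CompleteSpace (closedSpan b) := (closedSpan_isClosed b).completeSpace_coe
  infer_instance

/-- The orthogonal projection to the closed linear span of a family of vectors. -/
noncomputable def spanProj (b : ι → H) : H →L[ℝ] H := (closedSpan b).starProjection

theorem spanProj_mem (b : ι → H) (x : H) : spanProj b x ∈ closedSpan b :=
  Submodule.starProjection_apply_mem _ _

theorem norm_spanProj_le (b : ι → H) (x : H) : ‖spanProj b x‖ ≤ ‖x‖ :=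
  Submodule.norm_starProjection_apply_le _ _

theorem inner_spanProj_left (b : ι → H) (x y : H) :
    inner ℝ (spanProj b x) y = inner ℝ x (spanProj b y) :=
  Submodule.inner_starProjection_left_eq_right _ _ _

theorem spanProj_of_mem {b : ι → H} {x : H} (hx : x ∈ closedSpan b) : spanProj b x = x :=
  Submodule.starProjection_eq_self_iff.2 hx

theorem spanProj_spanProj (b : ι → H) (x : H) : spanProj b (spanProj b x) = spanProj b x :=
  spanProj_of_mem (spanProj_mem b x)

theorem inner_spanProj_self (b : ι → H) (x : H) : inner ℝ x (spanProj b x) = ‖spanProj b x‖ ^ 2 := by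
  rw [← real_inner_self_eq_norm_sq, inner_spanProj_left, spanProj_spanProj]

theorem inner_apply_spanProj (b : ι → H) (i : ι) (x : H) :
    inner ℝ (b i) (spanProj b x) = inner ℝ (b i) x := by
  rw [← inner_spanProj_left, spanProj_of_mem (mem_closedSpan b i)]

theorem eq_spanProj {b : ι → H} {x v : H} (hv : v ∈ closedSpan b)
    (h : ∀ i, inner ℝ (b i) (x - v) = 0) : spanProj b x = v := by
  refine Submodule.eq_starProjection_of_mem_of_inner_eq_zero hv fun w hw => ?_
  rw [real_inner_comm]
  exact inner_eq_zero_of_closedSpan h hw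

theorem spanProj_congr {κ : Type*} {b : ι → H} {c : κ → H} (h : ∀ i, b i ∈ closedSpan c)
    (h' : ∀ j, c j ∈ closedSpan b) : spanProj b = spanProj c := by
  ext x
  refine eq_spanProj ?_ fun i => ?_
  · rw [closedSpan_congr h h']; exact spanProj_mem c x
  · rw [inner_sub_right, ← spanProj_of_mem (h i), inner_spanProj_left, inner_spanProj_left,
      spanProj_spanProj, sub_self]

theorem spanProj_map {κ : Type*} {b : ι → H} {c : κ → H} (U : H ≃ₗᵢ[ℝ] H)
    (h : ∀ i, ∃ j, U (b i) = c j) (h' : ∀ j, ∃ i, U (b i) = c j) (x : H) :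
    spanProj c (U x) = U (spanProj b x) := by
  refine eq_spanProj ?_ fun j => ?_
  · have : closedSpan b ≤ (closedSpan c).comap (U.toLinearEquiv : H →ₗ[ℝ] H) := by
      refine closedSpan_le ((closedSpan_isClosed c).preimage U.continuous) fun i => ?_
      obtain ⟨j, hj⟩ := h i
      simpa [hj] using mem_closedSpan c j
    exact this (spanProj_mem b x)
  · obtain ⟨i, hi⟩ := h' j
    rw [← hi, ← map_sub, LinearIsometryEquiv.inner_map_map, inner_sub_right, inner_apply_spanProj,
      sub_self]

/-- Since `x` itself has residual zero, the minimum of the residual is zero, so a least-squares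
solution reproduces every inner product exactly. -/
theorem isLeastSquares_transposeApply_iff (b : ι → H) (x y : H) :
    IsLeastSquares b (transposeApply b x) y ↔ spanProj b y = spanProj b x := by
  constructor
  · intro h
    have h0 := h x
    rw [residualSq_transposeApply_self, nonpos_iff_eq_zero, residualSq, ENNReal.tsum_eq_zero] at h0
    refine eq_spanProj (spanProj_mem b x) fun i => ?_
    have h1 := h0 i
    rw [ENNReal.ofReal_eq_zero] at h1
    have h2 := pow_eq_zero_iff (two_ne_zero) |>.1 (le_antisymm h1 (sq_nonneg _))
    rw [inner_sub_right, inner_apply_spanProj]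
    simp only [transposeApply] at h2
    linarith
  · intro h z
    have : residualSq b (transposeApply b x) y = 0 := by
      rw [residualSq, ENNReal.tsum_eq_zero]
      intro i
      simp only [transposeApply]
      rw [← inner_apply_spanProj b i x, ← inner_apply_spanProj b i y, h]
      simp
    rw [this]
    exact zero_le

/-- The pseudoinverse is defined by choosing a solution of minimal norm, so uniqueness is needed:
any solution has projection `spanProj b x`, and by Pythagoras it is no longer than this projection
only if it equals it. -/
theorem pinvTranspose_transposeApply (b : ι → H) (x : H) :
    pinvTranspose b (transposeApply b x) = spanProj b x := by
  have hP : IsPinvSolution b (transposeApply b x) (spanProj b x) := by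
    refine ⟨(isLeastSquares_transposeApply_iff b x _).2 (spanProj_spanProj b x), fun y hy => ?_⟩
    rw [← (isLeastSquares_transposeApply_iff b x y).1 hy]
    exact norm_spanProj_le b y
  have hex : ∃ z, IsPinvSolution b (transposeApply b x) z := ⟨_, hP⟩
  rw [pinvTranspose, dif_pos hex]
  obtain ⟨h1, h2⟩ := hex.choose_spec
  set z := hex.choose
  have h3 := (isLeastSquares_transposeApply_iff b x z).1 h1
  have h4 := h2 _ hP.1
  rw [← h3] at h4 ⊢
  have h5 : ‖z - spanProj b z‖ ^ 2 ≤ 0 := by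
    rw [norm_sub_sq_real, inner_spanProj_self]
    nlinarith [norm_nonneg z]
  have h6 : ‖z - spanProj b z‖ = 0 := by nlinarith [norm_nonneg (z - spanProj b z)]
  exact sub_eq_zero.1 (norm_eq_zero.1 h6)

/-- The trace bound: if only `N` of the vectors `b i` are not orthogonal to an orthonormal family,
then the projection to their closed span has at most trace `N` on this family. -/
theorem sum_norm_sq_spanProj_le {κ : Type*} [Fintype κ] {e : κ → H} (he : Orthonormal ℝ e)
    (b : ι → H) (s : Finset ι) (hs : ∀ i, i ∉ s → ∀ k, inner ℝ (e k) (b i) = 0) :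
    ∑ k, ‖spanProj b (e k)‖ ^ 2 ≤ s.card := by
  classical
  set K : Submodule ℝ H := Submodule.span ℝ (Set.range e)
  have : FiniteDimensional ℝ K := FiniteDimensional.span_of_finite ℝ (Set.finite_range e)
  -- `W` contains the image of the whole closed span under projection to `K`: vectors outside `s`
  -- project to zero, and finite dimension makes `W` closed. Its dimension is at most the
  -- cardinality of `s`.
  set W : Submodule ℝ H := Submodule.span ℝ ((fun i => K.starProjection (b i)) '' (s : Set ι))
  have : FiniteDimensional ℝ W :=
    FiniteDimensional.span_of_finite ℝ (s.finite_toSet.image _)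
  have hWK : W ≤ K := by
    refine Submodule.span_le.2 ?_
    rintro _ ⟨i, -, rfl⟩
    exact Submodule.starProjection_apply_mem _ _
  have heK : ∀ k, e k ∈ K := fun k => Submodule.subset_span ⟨k, rfl⟩
  have hb : ∀ i, K.starProjection (b i) ∈ W := by
    intro i
    by_cases hi : i ∈ s
    · exact Submodule.subset_span ⟨i, hi, rfl⟩
    · have : K.starProjection (b i) = 0 := by
        rw [Submodule.starProjection_apply_eq_zero_iff, Submodule.mem_orthogonal]
        intro u hu
        induction hu using Submodule.span_induction with
        | mem x hx => obtain ⟨k, rfl⟩ := hx; exact hs i hi k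
        | zero => simp
        | add x y _ _ hx hy => rw [inner_add_left, hx, hy, add_zero]
        | smul a x _ hx => rw [inner_smul_left, hx, mul_zero]
      rw [this]; exact W.zero_mem
  have hV : ∀ v ∈ closedSpan b, K.starProjection v ∈ W := by
    intro v hv
    have : closedSpan b ≤ W.comap (K.starProjection : H →ₗ[ℝ] H) :=
      closedSpan_le (W.closed_of_finiteDimensional.preimage K.starProjection.continuous) hb
    exact this hv
  have h1 : ∀ k, ‖spanProj b (e k)‖ ≤ ‖W.starProjection (e k)‖ := by
    intro k
    set p := spanProj b (e k)
    -- Seen from `e k ∈ K`, the vector `p` is the same as its projection to `K`, which lies in `W`;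
    -- Cauchy-Schwarz then gives `‖p‖ ≤ ‖W.starProjection (e k)‖`.
    have hp : ‖p‖ ^ 2 = inner ℝ (W.starProjection (e k)) p := by
      rw [← inner_spanProj_self]
      calc inner ℝ (e k) p = inner ℝ (K.starProjection (e k)) p := by
            rw [Submodule.starProjection_eq_self_iff.2 (heK k)]
        _ = inner ℝ (e k) (K.starProjection p) := Submodule.inner_starProjection_left_eq_right _ _ _
        _ = inner ℝ (e k) (W.starProjection (K.starProjection p)) := by
            rw [Submodule.starProjection_eq_self_iff.2 (hV p (spanProj_mem b _))]
        _ = inner ℝ (W.starProjection (e k)) (K.starProjection p) :=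
            (Submodule.inner_starProjection_left_eq_right _ _ _).symm
        _ = inner ℝ (K.starProjection (W.starProjection (e k))) p :=
            (Submodule.inner_starProjection_left_eq_right _ _ _).symm
        _ = inner ℝ (W.starProjection (e k)) p := by
            rw [Submodule.starProjection_eq_self_iff.2
              (hWK (Submodule.starProjection_apply_mem W (e k)))]
    have h2 := real_inner_le_norm (W.starProjection (e k)) p
    rw [← hp, sq] at h2
    by_contra hlt
    push Not at hlt
    have : 0 < ‖p‖ := (norm_nonneg _).trans_lt hlt
    nlinarith
  let w := stdOrthonormalBasis ℝ W
  have h2 : ∀ k, ‖W.starProjection (e k)‖ ^ 2 = ∑ j, (inner ℝ (w j : H) (e k)) ^ 2 := by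
    intro k
    have h3 := w.sum_sq_norm_inner_right (W.orthogonalProjectionOnto (e k))
    rw [Submodule.starProjection_apply, Submodule.norm_coe, ← h3]
    refine Finset.sum_congr rfl fun j _ => ?_
    rw [Submodule.inner_orthogonalProjectionOnto_eq_of_mem_left, Real.norm_eq_abs, sq_abs]
  -- After exchanging the sums, Bessel's inequality for the family `e` bounds each basis vector of
  -- `W` by one.
  calc ∑ k, ‖spanProj b (e k)‖ ^ 2 ≤ ∑ k, ∑ j, (inner ℝ (w j : H) (e k)) ^ 2 := by
        refine Finset.sum_le_sum fun k _ => ?_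
        rw [← h2]
        exact pow_le_pow_left₀ (norm_nonneg _) (h1 k) 2
    _ = ∑ j, ∑ k, (inner ℝ (w j : H) (e k)) ^ 2 := Finset.sum_comm
    _ ≤ ∑ j : Fin (Module.finrank ℝ W), (1 : ℝ) := by
        refine Finset.sum_le_sum fun j _ => ?_
        have h4 := he.sum_inner_products_le (w j : H) (s := Finset.univ)
        have h5 : ‖(w j : H)‖ = 1 := by rw [Submodule.norm_coe, w.orthonormal.1 j]
        simp only [Real.norm_eq_abs, sq_abs, h5, one_pow] at h4
        simpa only [real_inner_comm] using h4
    _ = (Module.finrank ℝ W : ℝ) := by simp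
    _ ≤ s.card := by
        have h6 : W = Submodule.span ℝ ((s.image fun i => K.starProjection (b i) : Finset H) : Set H) := by
          rw [Finset.coe_image]
        have h7 := finrank_span_finset_le_card (R := ℝ) (s.image fun i => K.starProjection (b i))
        rw [Set.finrank, ← h6] at h7
        exact_mod_cast h7.trans Finset.card_image_le

end Hilbert

/-! ### Measurability of random vectors and random projections -/

section Measurability

variable {H : Type*} [NormedAddCommGroup H] [InnerProductSpace ℝ H]
  [SecondCountableTopology H] [MeasurableSpace H] [BorelSpace H]
  {Ω : Type*} [MeasurableSpace Ω]

/-- Weakly measurable maps to separable Hilbert spaces are measurable. -/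
theorem measurable_of_inner {F : Ω → H} (h : ∀ y, Measurable fun ω => inner ℝ y (F ω)) :
    Measurable F := by
  have hn : ∀ z : H, Measurable fun ω => ‖F ω - z‖ := by
    intro z
    set D := TopologicalSpace.denseSeq H
    have hD := TopologicalSpace.denseRange_denseSeq H
    refine measurable_of_Ioi fun a => ?_
    rcases lt_or_ge a 0 with ha | ha
    · convert MeasurableSet.univ
      ext ω
      simpa using ha.trans_le (norm_nonneg _)
    -- The vector `F ω - z` itself satisfies the strict inequality, which is an open condition on
    -- the test vector, so a member of the dense sequence satisfies it too. For negative `a` this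
    -- witness would fail when the vector is zero.
    · have : (fun ω => ‖F ω - z‖) ⁻¹' Set.Ioi a =
          ⋃ n, {ω | a * ‖D n‖ < inner ℝ (D n) (F ω - z)} := by
        ext ω
        simp only [Set.mem_preimage, Set.mem_Ioi, Set.mem_iUnion, Set.mem_ofPred_eq]
        constructor
        · intro h1
          have ho : IsOpen {y : H | a * ‖y‖ < inner ℝ y (F ω - z)} :=
            isOpen_lt (by fun_prop) (by fun_prop)
          obtain ⟨n, hn⟩ := hD.exists_mem_open ho ⟨F ω - z, by
            simp only [Set.mem_ofPred_eq, real_inner_self_eq_norm_sq]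
            nlinarith⟩
          exact ⟨n, hn⟩
        · rintro ⟨n, hn⟩
          have h2 := hn.trans_le (real_inner_le_norm _ _)
          by_contra h3
          push Not at h3
          nlinarith [norm_nonneg (D n)]
      rw [this]
      refine MeasurableSet.iUnion fun n => measurableSet_lt measurable_const ?_
      simp only [inner_sub_right]
      exact (h _).sub measurable_const
  refine measurable_of_isOpen fun s hs => ?_
  obtain ⟨T, hTc, hT⟩ : ∃ T : Set (H × ℝ), T.Countable ∧ s = ⋃ p ∈ T, Metric.ball p.1 p.2 := by
    set D := TopologicalSpace.denseSeq H
    have hD := TopologicalSpace.denseRange_denseSeq H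
    refine ⟨{p | ∃ n : ℕ, ∃ q : ℚ, p = (D n, (q : ℝ)) ∧ Metric.ball p.1 p.2 ⊆ s}, ?_, ?_⟩
    · refine (Set.countable_range fun nq : ℕ × ℚ => (D nq.1, (nq.2 : ℝ))).mono ?_
      rintro p ⟨n, q, rfl, -⟩
      exact ⟨(n, q), rfl⟩
    · ext x
      simp only [Set.mem_iUnion, exists_prop]
      constructor
      · intro hx
        obtain ⟨ε, hε, hb⟩ := Metric.isOpen_iff.1 hs x hx
        obtain ⟨n, hn⟩ := hD.exists_dist_lt x (half_pos hε)
        obtain ⟨q, hq1, hq2⟩ := exists_rat_btwn hn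
        refine ⟨(D n, (q : ℝ)), ⟨n, q, rfl, fun y hy => hb ?_⟩, ?_⟩
        · rw [Metric.mem_ball] at hy ⊢
          have := dist_triangle y (D n) x
          rw [dist_comm (D n) x] at this
          linarith
        · exact hq1
      · rintro ⟨p, ⟨n, q, rfl, hb⟩, hx⟩
        exact hb hx
  rw [hT, Set.preimage_iUnion₂]
  refine MeasurableSet.biUnion hTc fun p _ => ?_
  have : F ⁻¹' Metric.ball p.1 p.2 = {ω | ‖F ω - p.1‖ < p.2} := by
    ext ω; simp [dist_eq_norm]
  rw [this]
  exact measurableSet_lt (hn _) measurable_const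

/-- The distance from `x` to the span is an infimum over the countably many finite rational
combinations of the vectors, hence measurable. Pythagoras turns it into `‖P x‖ ^ 2`, and
polarization recovers `⟨y, P x⟩` from such squares. -/
theorem measurable_spanProj [CompleteSpace H] {ι : Type*} [Countable ι] {b : Ω → ι → H}
    (hb : ∀ i, Measurable fun ω => b ω i) (x : H) : Measurable fun ω => spanProj (b ω) x := by
  have hd : ∀ x : H, Measurable fun ω => ‖x - spanProj (b ω) x‖ := by
    intro x
    refine measurable_of_Iio fun a => ?_
    have : (fun ω => ‖x - spanProj (b ω) x‖) ⁻¹' Set.Iio a =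
        ⋃ c : ι →₀ ℚ, {ω | ‖x - ∑ i ∈ c.support, (c i : ℝ) • b ω i‖ < a} := by
      ext ω
      simp only [Set.mem_preimage, Set.mem_Iio, Set.mem_iUnion, Set.mem_ofPred_eq]
      constructor
      · intro h
        have hmem : spanProj (b ω) x ∈ closure (Submodule.span ℝ (Set.range (b ω)) : Set H) := by
          have := spanProj_mem (b ω) x
          rwa [closedSpan, ← SetLike.mem_coe, Submodule.topologicalClosure_coe] at this
        have ho : IsOpen {v : H | ‖x - v‖ < a} := isOpen_lt (by fun_prop) (by fun_prop)
        obtain ⟨v, hv1, hv2⟩ := mem_closure_iff.1 hmem _ ho h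
        obtain ⟨r, hr⟩ := (Finsupp.mem_span_range_iff_exists_finsupp).1 hv2
        set s := r.support
        have ho' : IsOpen {d : s → ℝ | ‖x - ∑ i : s, d i • b ω i‖ < a} :=
          isOpen_lt (by fun_prop) (by fun_prop)
        have hdr : DenseRange (fun (q : s → ℚ) (i : s) => (q i : ℝ)) :=
          DenseRange.piMap fun _ => Rat.denseRange_cast
        obtain ⟨q, hq⟩ := hdr.exists_mem_open ho' ⟨fun i => r i, by
          have : ∑ i : s, r i • b ω i = v := by
            rw [← hr, Finsupp.sum, Finset.sum_coe_sort s fun i => r i • b ω i]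
          change ‖x - ∑ i : s, r i • b ω i‖ < a
          rw [this]
          exact hv1⟩
        classical
        refine ⟨Finsupp.onFinset s (fun i => if h : i ∈ s then q ⟨i, h⟩ else 0) (by
          intro i hi; by_contra h; simp [h] at hi), ?_⟩
        have hq' : ‖x - ∑ i : s, (q i : ℝ) • b ω i‖ < a := hq
        convert hq' using 3
        rw [Finset.sum_subset (Finsupp.support_onFinset_subset) (by
          intro i _ hi
          rw [Finsupp.notMem_support_iff] at hi
          rw [hi]; simp), ← Finset.sum_coe_sort]
        refine Finset.sum_congr rfl fun i _ => ?_
        simp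
      · rintro ⟨c, hc⟩
        have hm : ∑ i ∈ c.support, (c i : ℝ) • b ω i ∈ closedSpan (b ω) :=
          Submodule.sum_mem _ fun i _ => Submodule.smul_mem _ _ (mem_closedSpan _ i)
        refine lt_of_le_of_lt ?_ hc
        rw [spanProj, Submodule.starProjection_minimal]
        exact ciInf_le ⟨0, by rintro _ ⟨w, rfl⟩; exact norm_nonneg _⟩
          (⟨_, hm⟩ : closedSpan (b ω))
    rw [this]
    refine MeasurableSet.iUnion fun c => measurableSet_lt ?_ measurable_const
    exact ((Finset.measurable_fun_sum _ fun i _ => (hb i).const_smul (c i : ℝ)).const_sub x).norm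
  have hsq : ∀ x : H, Measurable fun ω => ‖spanProj (b ω) x‖ ^ 2 := by
    intro x
    have : (fun ω => ‖spanProj (b ω) x‖ ^ 2) = fun ω => ‖x‖ ^ 2 - ‖x - spanProj (b ω) x‖ ^ 2 := by
      ext ω
      rw [norm_sub_sq_real, inner_spanProj_self]
      ring
    rw [this]
    exact measurable_const.sub ((hd x).pow_const 2)
  refine measurable_of_inner fun y => ?_
  have : (fun ω => inner ℝ y (spanProj (b ω) x)) =
      fun ω => (‖spanProj (b ω) (x + y)‖ ^ 2 - ‖spanProj (b ω) (x - y)‖ ^ 2) / 4 := by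
    ext ω
    have h : inner ℝ (spanProj (b ω) x) (spanProj (b ω) y) = inner ℝ y (spanProj (b ω) x) := by
      rw [real_inner_comm, inner_spanProj_left, spanProj_spanProj]
    rw [map_add, map_sub, norm_add_sq_real, norm_sub_sq_real, h]
    ring
  rw [this]
  exact ((hsq _).sub (hsq _)).div_const 4

end Measurability

attribute [local instance] configurations

/-! ### Square grids, and counting points by nonempty cells -/

section Cells

/-- The square of the grid of mesh size `1 / s` in which a point lies. -/
noncomputable def cell (s : ℝ) (p : Plane) : ℤ × ℤ := (⌊s * p 0⌋, ⌊s * p 1⌋)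

theorem measurable_cell (s : ℝ) : Measurable (cell s) := by
  have h : ∀ i, Measurable fun p : Plane => p i := fun i => by fun_prop
  exact ((Int.measurable_floor.comp ((h 0).const_mul s))).prodMk
    (Int.measurable_floor.comp ((h 1).const_mul s))

theorem measurableSet_cell (s : ℝ) (z : ℤ × ℤ) : MeasurableSet (cell s ⁻¹' {z}) :=
  measurable_cell s (measurableSet_singleton z)

theorem volume_cell {s : ℝ} (hs : 0 < s) (z : ℤ × ℤ) :
    volume (cell s ⁻¹' {z}) = ENNReal.ofReal (1 / s ^ 2) := by
  set b : Fin 2 → ℤ := ![z.1, z.2]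
  have h1 : cell s ⁻¹' {z} = (WithLp.ofLp : Plane → Fin 2 → ℝ) ⁻¹'
      (Set.univ.pi fun i => Set.Ico ((b i : ℝ) / s) ((b i + 1) / s)) := by
    ext p
    simp only [Set.mem_preimage, Set.mem_singleton_iff, cell, Prod.ext_iff, Int.floor_eq_iff,
      Set.mem_pi, Set.mem_univ, forall_const, Fin.forall_fin_two, Set.mem_Ico, div_le_iff₀ hs,
      lt_div_iff₀ hs, b, Matrix.cons_val_zero, Matrix.cons_val_one, mul_comm s]
  rw [h1, (PiLp.volume_preserving_ofLp (Fin 2)).measure_preimage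
    (MeasurableSet.univ_pi fun i => measurableSet_Ico).nullMeasurableSet, volume_pi_pi]
  simp only [Real.volume_Ico, Fin.prod_univ_two]
  rw [← ENNReal.ofReal_mul (by rw [← sub_div]; simp [hs.le])]
  congr 1
  field_simp
  ring

theorem eventually_injOn_cell {t : Set Plane} (ht : t.Finite) :
    ∀ᶠ n : ℕ in atTop, Set.InjOn (cell (n + 1)) t := by
  have h : ∀ p ∈ t, ∀ q ∈ t, ∀ᶠ n : ℕ in atTop,
      cell ((n : ℝ) + 1) p = cell (n + 1) q → p = q := by
    intro p _ q _
    by_cases hpq : p = q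
    · exact Eventually.of_forall fun _ _ => hpq
    obtain ⟨i, hi⟩ : ∃ i, p i ≠ q i := by
      by_contra h
      push Not at h
      exact hpq (PiLp.ext h)
    have hd : 0 < |p i - q i| := abs_pos.2 (sub_ne_zero.2 hi)
    obtain ⟨N, hN⟩ := exists_nat_gt (1 / |p i - q i|)
    filter_upwards [eventually_ge_atTop N] with n hn heq
    exfalso
    have h1 : ⌊((n : ℝ) + 1) * p i⌋ = ⌊((n : ℝ) + 1) * q i⌋ := by
      fin_cases i
      · exact congrArg Prod.fst heq
      · exact congrArg Prod.snd heq
    have h2 := Int.abs_sub_lt_one_of_floor_eq_floor h1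
    rw [← mul_sub, abs_mul, abs_of_pos (by positivity)] at h2
    rw [div_lt_iff₀ hd] at hN
    have h3 : (N : ℝ) ≤ n := by exact_mod_cast hn
    nlinarith
  have h2 : ∀ᶠ n : ℕ in atTop, ∀ p ∈ t, ∀ q ∈ t, cell ((n : ℝ) + 1) p = cell (n + 1) q → p = q := by
    rw [ht.eventually_all]
    intro p hp
    rw [ht.eventually_all]
    exact fun q hq => h p hp q hq
  filter_upwards [h2] with n hn p hp q hq
  exact hn p hp q hq

/-- Finitely many points fall into different cells of a sufficiently fine grid. This writes counting
events as countable combinations of void events. -/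
theorem natCast_le_encard_inter_iff (S A : Set Plane) (k : ℕ) :
    (k : ℕ∞) ≤ (S ∩ A).encard ↔ ∃ (n : ℕ) (F : Finset (ℤ × ℤ)), F.card = k ∧
      ∀ z ∈ F, ¬ S ∩ (A ∩ cell (n + 1) ⁻¹' {z}) = ∅ := by
  classical
  constructor
  · intro h
    obtain ⟨t, ht, htk⟩ := Set.exists_subset_encard_eq h
    have htf : t.Finite := Set.finite_of_encard_eq_coe htk
    obtain ⟨n, hn⟩ := (eventually_injOn_cell htf).exists
    refine ⟨n, htf.toFinset.image (cell (n + 1)), ?_, ?_⟩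
    · rw [Finset.card_image_of_injOn (by simpa using hn)]
      rw [htf.encard_eq_coe_toFinset_card] at htk
      exact_mod_cast htk
    · intro z hz
      obtain ⟨p, hp, rfl⟩ := Finset.mem_image.1 hz
      have hp' : p ∈ t := by simpa using hp
      exact Set.Nonempty.ne_empty ⟨p, (ht hp').1, (ht hp').2, rfl⟩
  · rintro ⟨n, F, rfl, hF⟩
    have hF' : ∀ z : F, ∃ p, p ∈ S ∩ A ∧ cell (n + 1) p = z := by
      intro z
      obtain ⟨p, h1, h2, h3⟩ := Set.nonempty_iff_ne_empty.2 (hF z z.2)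
      exact ⟨p, ⟨h1, h2⟩, h3⟩
    choose f hf hfz using hF'
    have hinj : Function.Injective f := by
      intro z w h
      apply Subtype.ext
      rw [← hfz, ← hfz, h]
    calc ((F.card : ℕ) : ℕ∞) = (Set.range f).encard := by
          rw [← Set.image_univ, hinj.encard_image, Set.encard_univ]
          simp
      _ ≤ (S ∩ A).encard := Set.encard_le_encard (by rintro _ ⟨z, rfl⟩; exact hf z)

end Cells

/-! ### Void probabilities determine the law; invariance under isometries -/

section Law

theorem measurable_count {A : Set Plane} (hA : MeasurableSet A) :
    Measurable fun S : Set Plane => (S ∩ A).encard :=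
  measurable_iff_comap_le.2 (le_iSup₂_of_le (f := fun (A : Set Plane) (_ : MeasurableSet A) =>
    MeasurableSpace.comap (fun S : Set Plane => (S ∩ A).encard) inferInstance) A hA le_rfl)

theorem measurable_configuration {Ω : Type*} {m : MeasurableSpace Ω} {X : Ω → Set Plane}
    (h : ∀ A, MeasurableSet A → Measurable fun ω => (X ω ∩ A).encard) : Measurable X := by
  rw [measurable_iff_comap_le, configurations, MeasurableSpace.comap_iSup]
  refine iSup_le fun A => ?_
  rw [MeasurableSpace.comap_iSup]
  refine iSup_le fun hA => ?_
  rw [MeasurableSpace.comap_comp]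
  exact (h A hA).comap_le

theorem measurableSet_void {A : Set Plane} (hA : MeasurableSet A) :
    MeasurableSet {S : Set Plane | S ∩ A = ∅} := by
  have : {S : Set Plane | S ∩ A = ∅} = (fun S : Set Plane => (S ∩ A).encard) ⁻¹' {0} := by
    ext S; simp
  rw [this]
  exact measurable_count hA (measurableSet_singleton _)

/-- The events that a set of finite area contains no point. -/
def voidEvents : Set (Set (Set Plane)) :=
  {E | ∃ A : Set Plane, MeasurableSet A ∧ volume A ≠ ∞ ∧ E = {S | S ∩ A = ∅}}

theorem isPiSystem_voidEvents : IsPiSystem voidEvents := by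
  rintro _ ⟨A, hA, hA', rfl⟩ _ ⟨B, hB, hB', rfl⟩ -
  refine ⟨A ∪ B, hA.union hB, measure_union_ne_top hA' hB', ?_⟩
  ext S
  simp [Set.inter_union_distrib_left]

/-- The void events form a π-system, so this makes void probabilities determine the law of a
configuration. -/
theorem configurations_eq_generateFrom :
    configurations = MeasurableSpace.generateFrom voidEvents := by
  apply le_antisymm
  · refine iSup₂_le fun A hA => ?_
    rw [← measurable_iff_comap_le]
    refine (@ENat.measurable_iff _ (MeasurableSpace.generateFrom voidEvents) _).2 ?_
    have hge : ∀ k : ℕ, MeasurableSet[MeasurableSpace.generateFrom voidEvents]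
        {S : Set Plane | (k : ℕ∞) ≤ (S ∩ A).encard} := by
      intro k
      have : {S : Set Plane | (k : ℕ∞) ≤ (S ∩ A).encard} =
          ⋃ (n : ℕ) (F : Finset (ℤ × ℤ)) (_ : F.card = k),
            ⋂ z ∈ F, {S : Set Plane | S ∩ (A ∩ cell (n + 1) ⁻¹' {z}) = ∅}ᶜ := by
        ext S
        rw [Set.mem_ofPred_eq, natCast_le_encard_inter_iff]
        simp
      rw [this]
      refine MeasurableSet.iUnion fun n => MeasurableSet.iUnion fun F => MeasurableSet.iUnion
        fun _ => Finset.measurableSet_biInter _ fun z _ => MeasurableSet.compl ?_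
      refine MeasurableSpace.measurableSet_generateFrom ⟨_, hA.inter (measurableSet_cell _ _),
        ?_, rfl⟩
      -- The area is finite because of the cell, even when `A` has infinite area.
      refine ne_top_of_le_ne_top ?_ (measure_mono Set.inter_subset_right)
      rw [volume_cell (by positivity)]
      exact ENNReal.ofReal_ne_top
    intro k
    have : (fun S : Set Plane => (S ∩ A).encard) ⁻¹' {(k : ℕ∞)} =
        {S : Set Plane | (k : ℕ∞) ≤ (S ∩ A).encard} \
          {S : Set Plane | ((k + 1 : ℕ) : ℕ∞) ≤ (S ∩ A).encard} := by
      ext S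
      simp only [Set.mem_preimage, Set.mem_singleton_iff, Set.mem_sdiff, Set.mem_ofPred_eq, not_le]
      push_cast
      rw [ENat.lt_add_one_iff (by simp)]
      exact ⟨fun h => ⟨h.ge, h.le⟩, fun h => le_antisymm h.2 h.1⟩
    rw [this]
    exact (hge k).diff (hge (k + 1))
  · refine MeasurableSpace.generateFrom_le ?_
    rintro _ ⟨A, hA, -, rfl⟩
    exact measurableSet_void hA

variable {Ω : Type*} [MeasurableSpace Ω] {P : Measure Ω} {ρ : ℝ≥0}

theorem IsPoissonProcess.measurable_count {X : Ω → Set Plane} (hX : IsPoissonProcess P ρ X)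
    {A : Set Plane} (hA : MeasurableSet A) : Measurable fun ω => (X ω ∩ A).encard :=
  (RandomMesh.measurable_count hA).comp hX.measurable

/-- A Poisson process has the same law as its image under a volume preserving bijection. -/
theorem IsPoissonProcess.map_image [IsProbabilityMeasure P] {X : Ω → Set Plane}
    (hX : IsPoissonProcess P ρ X) {g : Plane → Plane} (hg : MeasurePreserving g)
    (hinj : Function.Injective g) :
    Measurable (fun ω => g '' X ω) ∧ P.map (fun ω => g '' X ω) = P.map X := by
  have hcount : ∀ A ω, (g '' X ω ∩ A).encard = (X ω ∩ g ⁻¹' A).encard := by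
    intro A ω
    rw [← hinj.encard_image (X ω ∩ g ⁻¹' A), Set.image_inter_preimage]
  have hm : Measurable fun ω => g '' X ω := by
    refine measurable_configuration fun A hA => ?_
    simp only [hcount]
    exact hX.measurable_count (hg.measurable hA)
  refine ⟨hm, ?_⟩
  have := Measure.isProbabilityMeasure_map (μ := P) hm.aemeasurable
  have := Measure.isProbabilityMeasure_map (μ := P) hX.measurable.aemeasurable
  refine ext_of_generate_finite voidEvents configurations_eq_generateFrom isPiSystem_voidEvents ?_
    (by simp)
  rintro _ ⟨A, hA, hA', rfl⟩
  rw [Measure.map_apply hm (measurableSet_void hA),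
    Measure.map_apply hX.measurable (measurableSet_void hA)]
  have hvol : volume (g ⁻¹' A) = volume A := hg.measure_preimage hA.nullMeasurableSet
  have h0 : ∀ B, MeasurableSet B → P {ω | X ω ∩ B = ∅} =
      P.map (fun ω => (X ω ∩ B).encard) {0} := by
    intro B hB
    rw [Measure.map_apply (hX.measurable_count hB) (measurableSet_singleton _)]
    congr 1
    ext ω
    simp
  have h1 : (fun ω => g '' X ω) ⁻¹' {S | S ∩ A = ∅} = {ω | X ω ∩ g ⁻¹' A = ∅} := by
    ext ω
    simp only [Set.mem_preimage, Set.mem_ofPred_eq]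
    rw [← Set.encard_eq_zero, hcount, Set.encard_eq_zero]
  have h2 : X ⁻¹' {S | S ∩ A = ∅} = {ω | X ω ∩ A = ∅} := rfl
  rw [h1, h2, h0 _ (hg.measurable hA), h0 _ hA, hX.count_law _ (hg.measurable hA) (hvol ▸ hA'),
    hX.count_law _ hA hA', hvol]

/-- By independence both joint laws are products of their marginals, and each marginal is invariant.
-/
theorem map_image_joint [IsProbabilityMeasure P] {L : ℕ} {X : Fin L → Ω → Set Plane}
    (hX : ∀ l, IsPoissonProcess P ρ (X l)) (hind : IndependentProcesses P X)
    {g : Plane → Plane} (hg : MeasurePreserving g) (hinj : Function.Injective g) :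
    Measurable (fun ω l => X l ω) ∧ Measurable (fun ω l => g '' X l ω) ∧
      P.map (fun ω l => g '' X l ω) = P.map (fun ω l => X l ω) := by
  have himg : Measurable fun S : Set Plane => g '' S := by
    refine measurable_configuration fun A hA => ?_
    have : (fun S => (g '' S ∩ A).encard) = fun S => (S ∩ g ⁻¹' A).encard := by
      ext1 S
      rw [← hinj.encard_image (S ∩ g ⁻¹' A), Set.image_inter_preimage]
    rw [this]
    exact measurable_count (hg.measurable hA)
  have h1 := (iIndepFun_iff_map_fun_eq_pi_map fun l => (hX l).measurable.aemeasurable).1 hind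
  have hind' : iIndepFun (fun l ω => g '' X l ω) P := hind.comp (fun _ S => g '' S) fun _ => himg
  have h2 := (iIndepFun_iff_map_fun_eq_pi_map
    fun l => ((hX l).map_image hg hinj).1.aemeasurable).1 hind'
  refine ⟨measurable_pi_lambda _ fun l => (hX l).measurable,
    measurable_pi_lambda _ fun l => ((hX l).map_image hg hinj).1, ?_⟩
  rw [h1, h2]
  congr 1
  ext1 l
  exact ((hX l).map_image hg hinj).2

end Law

/-! ### Local finiteness of configurations -/

section LocallyFinite

/-- A configuration with finitely many points in every bounded set. -/
def LocallyFinite (S : Set Plane) : Prop := ∀ r : ℝ, (S ∩ Metric.closedBall 0 r).Finite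

/-- Counts take values in `ℕ∞`, but the Poisson law gives no mass to `⊤`; discs of integer radius
suffice. -/
theorem IsPoissonProcess.ae_locallyFinite {Ω : Type*} [MeasurableSpace Ω] {P : Measure Ω}
    {ρ : ℝ≥0} {X : Ω → Set Plane} (hX : IsPoissonProcess P ρ X) :
    ∀ᵐ ω ∂P, LocallyFinite (X ω) := by
  have h : ∀ n : ℕ, ∀ᵐ ω ∂P, (X ω ∩ Metric.closedBall 0 (n : ℝ)).Finite := by
    intro n
    have h1 := hX.count_law (Metric.closedBall 0 (n : ℝ)) Metric.isClosed_closedBall.measurableSet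
      measure_closedBall_lt_top.ne
    have h2 : P.map (fun ω => (X ω ∩ Metric.closedBall 0 (n : ℝ)).encard) {⊤} = 0 := by
      rw [h1, Measure.map_apply .of_discrete (measurableSet_singleton _)]
      convert measure_empty (μ := poissonMeasure _)
      ext k
      simp
    rw [Measure.map_apply (hX.measurable_count Metric.isClosed_closedBall.measurableSet)
      (measurableSet_singleton _)] at h2
    filter_upwards [measure_eq_zero_iff_ae_notMem.1 h2] with ω hω
    simpa using hω
  filter_upwards [ae_all_iff.2 h] with ω hω r
  obtain ⟨n, hn⟩ := exists_nat_ge r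
  exact (hω n).subset (Set.inter_subset_inter_right _ (Metric.closedBall_subset_closedBall hn))

theorem LocallyFinite.image {S : Set Plane} (hS : LocallyFinite S) (g : Plane ≃ᵃⁱ[ℝ] Plane) :
    LocallyFinite (g '' S) := by
  intro r
  refine ((hS (r + dist (g 0) 0)).image g).subset ?_
  rintro _ ⟨⟨p, hp, rfl⟩, hr⟩
  refine ⟨p, ⟨hp, ?_⟩, rfl⟩
  rw [Metric.mem_closedBall] at hr ⊢
  calc dist p 0 = dist (g p) (g 0) := (g.dist_map _ _).symm
    _ ≤ dist (g p) 0 + dist 0 (g 0) := dist_triangle _ _ _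
    _ ≤ _ := by rw [dist_comm 0 (g 0)]; linarith

/-- This lets the points of a varying configuration be addressed by a fixed countable index set. -/
theorem LocallyFinite.exists_isolating {S : Set Plane} (hS : LocallyFinite S) {p : Plane}
    (hp : p ∈ S) :
    ∃ D ∈ TopologicalSpace.countableBasis Plane, S ∩ D = {p} := by
  have hf : ((S ∩ Metric.closedBall 0 (‖p‖ + 1)) \ {p}).Finite := (hS _).subset Set.sdiff_subset
  have ho : IsOpen (((S ∩ Metric.closedBall 0 (‖p‖ + 1)) \ {p})ᶜ ∩ Metric.ball p 1) :=
    hf.isClosed.isOpen_compl.inter Metric.isOpen_ball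
  obtain ⟨D, hD, hpD, hDs⟩ := (TopologicalSpace.isBasis_countableBasis Plane).exists_subset_of_mem_open
    (a := p) (by simp) ho
  refine ⟨D, hD, Set.Subset.antisymm ?_ (by simpa using ⟨hp, hpD⟩)⟩
  rintro q ⟨hq, hqD⟩
  obtain ⟨h1, h2⟩ := hDs hqD
  by_contra hne
  refine h1 ⟨⟨hq, ?_⟩, hne⟩
  rw [mem_closedBall_zero_iff]
  rw [Metric.mem_ball, dist_eq_norm] at h2
  have := norm_add_le (q - p) p
  rw [sub_add_cancel] at this
  linarith

end LocallyFinite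

/-! ### Measurable enumeration of the Delaunay triangles -/

section Isolated

open Classical in
/-- The point of `S` in `D`, if there is exactly one. -/
noncomputable def pointIn (D S : Set Plane) : Plane :=
  if h : ∃ p, S ∩ D = {p} then h.choose else 0

theorem pointIn_eq {D S : Set Plane} {p : Plane} (h : S ∩ D = {p}) : pointIn D S = p := by
  have hex : ∃ p, S ∩ D = {p} := ⟨p, h⟩
  rw [pointIn, dif_pos hex]
  exact (Set.singleton_injective (h ▸ hex.choose_spec)).symm

theorem inter_eq_singleton_pointIn {D S : Set Plane} (h : (S ∩ D).encard = 1) :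
    S ∩ D = {pointIn D S} := by
  obtain ⟨p, hp⟩ := Set.encard_eq_one.1 h
  rw [pointIn_eq hp, hp]

theorem pointIn_mem {D S : Set Plane} (h : (S ∩ D).encard = 1) : pointIn D S ∈ S := by
  have : pointIn D S ∈ S ∩ D := by rw [inter_eq_singleton_pointIn h]; rfl
  exact this.1

theorem measurableSet_encard_eq {D : Set Plane} (hD : MeasurableSet D) (k : ℕ∞) :
    MeasurableSet {S : Set Plane | (S ∩ D).encard = k} :=
  measurable_count hD (measurableSet_singleton k)

theorem measurable_pointIn {D : Set Plane} (hD : MeasurableSet D) : Measurable (pointIn D) := by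
  intro A hA
  have : pointIn D ⁻¹' A = ({S | (S ∩ D).encard = 1} ∩ {S | (S ∩ (D ∩ A)).encard = 1}) ∪
      ({S | (S ∩ D).encard = 1}ᶜ ∩ {_S | (0 : Plane) ∈ A}) := by
    ext S
    simp only [Set.mem_preimage, Set.mem_union, Set.mem_inter_iff, Set.mem_ofPred_eq,
      Set.mem_compl_iff]
    by_cases h : (S ∩ D).encard = 1
    · have h1 := inter_eq_singleton_pointIn h
      simp only [h, true_and, not_true_eq_false, false_and, or_false]
      rw [← Set.inter_assoc, h1]
      by_cases hp : pointIn D S ∈ A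
      · simp [hp]
      · simp [hp]
    · have h1 : pointIn D S = 0 := by
        rw [pointIn, dif_neg]
        rintro ⟨p, hp⟩
        exact h (Set.encard_eq_one.2 ⟨p, hp⟩)
      simp [h, h1]
  rw [this]
  exact ((measurableSet_encard_eq hD 1).inter (measurableSet_encard_eq (hD.inter hA) 1)).union
    ((measurableSet_encard_eq hD 1).compl.inter (MeasurableSet.const _))

/-- The members of a countable basis of the topology of the plane. -/
abbrev BasicSet := TopologicalSpace.countableBasis Plane

theorem measurableSet_basicSet (D : BasicSet) : MeasurableSet (D : Set Plane) :=
  (TopologicalSpace.isOpen_of_mem_countableBasis D.2).measurableSet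

instance : Countable BasicSet := (TopologicalSpace.countable_countableBasis Plane).to_subtype

open Classical in
/-- The sets `D i` isolate the vertices of a Delaunay triangle. -/
def IsolatesDelaunay (D : Fin 3 → BasicSet) (S : Set Plane) : Prop :=
  (∀ i, (S ∩ D i).encard = 1) ∧ (∀ i j, i ≠ j → pointIn (D i) S ≠ pointIn (D j) S) ∧
    ∃ z, (∀ i, dist (pointIn (D i) S) z = dist (pointIn (D 0) S) z) ∧
      ∀ E : BasicSet, dist (pointIn (D 0) S) z ≤
        dist (if (S ∩ E).encard = 1 then pointIn E S else pointIn (D 0) S) z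

/-- The projection of a closed set along the plane is measurable. -/
theorem measurableSet_exists_of_isClosed {Y : Type*} [TopologicalSpace Y] [MeasurableSpace Y]
    [BorelSpace Y] {C : Set (Y × Plane)} (hC : IsClosed C) :
    MeasurableSet {y | ∃ z, (y, z) ∈ C} := by
  -- Cut the plane into countably many compact discs; projection along a compact factor is a closed
  -- map.
  have : {y | ∃ z, (y, z) ∈ C} = ⋃ n : ℕ, (Prod.fst '' {q : Y × Metric.closedBall (0 : Plane) n |
      (q.1, (q.2 : Plane)) ∈ C}) := by
    ext y
    simp only [Set.mem_ofPred_eq, Set.mem_iUnion, Set.mem_image, Prod.exists, exists_and_right,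
      exists_eq_right, Subtype.exists]
    constructor
    · rintro ⟨z, hz⟩
      obtain ⟨n, hn⟩ := exists_nat_ge ‖z‖
      exact ⟨n, z, by simpa using hn, hz⟩
    · rintro ⟨n, z, -, hz⟩
      exact ⟨z, hz⟩
  rw [this]
  refine MeasurableSet.iUnion fun n => ?_
  have : CompactSpace (Metric.closedBall (0 : Plane) n) :=
    isCompact_iff_compactSpace.1 (isCompact_closedBall _ _)
  refine (isClosedMap_fst_of_compactSpace _ (hC.preimage ?_)).measurableSet
  fun_prop

/-- The circumcentre ranges over an uncountable set, but its conditions are closed jointly in the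
centre, the vertices and the countable family of isolated points, so projecting it away keeps
measurability. Basic sets that isolate no point contribute the first vertex, for which the
inequality is trivial. -/
theorem measurableSet_isolatesDelaunay (D : Fin 3 → BasicSet) :
    MeasurableSet {S | IsolatesDelaunay D S} := by
  classical
  have hp : ∀ i, Measurable (pointIn (D i)) := fun i => measurable_pointIn (measurableSet_basicSet (D i))
  have h1 : MeasurableSet {S : Set Plane | ∀ i, (S ∩ D i).encard = 1} := by
    simp only [Set.ofPred_forall]
    exact MeasurableSet.iInter fun i => measurableSet_encard_eq (measurableSet_basicSet (D i)) 1
  have h2 : MeasurableSet {S | ∀ i j, i ≠ j → pointIn (D i) S ≠ pointIn (D j) S} := by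
    simp only [Set.ofPred_forall]
    exact MeasurableSet.iInter fun i => MeasurableSet.iInter fun j => MeasurableSet.iInter fun _ =>
      (measurableSet_eq_fun (hp i) (hp j)).compl
  have hC : IsClosed {q : ((Fin 3 → Plane) × (BasicSet → Plane)) × Plane |
      (∀ i, dist (q.1.1 i) q.2 = dist (q.1.1 0) q.2) ∧
        ∀ E, dist (q.1.1 0) q.2 ≤ dist (q.1.2 E) q.2} := by
    simp only [Set.ofPred_and, Set.ofPred_forall]
    exact (isClosed_iInter fun i => isClosed_eq (by fun_prop) (by fun_prop)).inter
      (isClosed_iInter fun i => isClosed_le (by fun_prop) (by fun_prop))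
  have h3 : Measurable fun S => ((fun i => pointIn (D i) S : Fin 3 → Plane),
      (fun E => if (S ∩ E).encard = 1 then pointIn E S else pointIn (D 0) S : BasicSet → Plane)) :=
    Measurable.prodMk (measurable_pi_lambda _ hp) (measurable_pi_lambda _ fun E =>
      Measurable.ite (measurableSet_encard_eq (measurableSet_basicSet E) 1)
        (measurable_pointIn (measurableSet_basicSet E)) (hp 0))
  have h4 := h3 (measurableSet_exists_of_isClosed hC)
  exact h1.inter (h2.inter h4)

open Classical in
/-- The vertex set picked out by three isolating sets. -/
noncomputable def isolatedVertices (D : Fin 3 → BasicSet) (S : Set Plane) : Finset Plane :=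
  Finset.univ.image fun i => pointIn (D i) S

/-- Local finiteness ensures that every point of `S` is isolated by some basic set, so the countably
many inequalities cover all of `S`. -/
theorem IsolatesDelaunay.mem_delaunay {S : Set Plane} (hS : LocallyFinite S)
    {D : Fin 3 → BasicSet} (h : IsolatesDelaunay D S) : isolatedVertices D S ∈ delaunay S := by
  classical
  obtain ⟨h1, h2, z, h3, h4⟩ := h
  refine ⟨?_, ?_, z, dist (pointIn (D 0) S) z, ?_, ?_⟩
  · intro p hp
    obtain ⟨i, -, rfl⟩ := Finset.mem_image.1 (Finset.mem_coe.1 hp)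
    exact pointIn_mem (h1 i)
  · rw [isolatedVertices, Finset.card_image_of_injective]
    · simp
    · intro i j hij
      by_contra hne
      exact h2 i j hne hij
  · intro p hp
    obtain ⟨i, -, rfl⟩ := Finset.mem_image.1 hp
    exact h3 i
  · intro p hp
    obtain ⟨E, hE, hSE⟩ := hS.exists_isolating hp
    have := h4 ⟨E, hE⟩
    rwa [if_pos (by rw [hSE, Set.encard_singleton]), pointIn_eq hSE] at this

theorem exists_isolatesDelaunay {S : Set Plane} (hS : LocallyFinite S) {t : Finset Plane}
    (ht : t ∈ delaunay S) : ∃ D, IsolatesDelaunay D S ∧ isolatedVertices D S = t := by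
  classical
  obtain ⟨h1, h2, z, r, h3, h4⟩ := ht
  let e := t.equivFinOfCardEq h2
  have h5 : ∀ i, ∃ D ∈ TopologicalSpace.countableBasis Plane, S ∩ D = {(e.symm i : Plane)} :=
    fun i => hS.exists_isolating (h1 (e.symm i).2)
  choose D hD hSD using h5
  have h6 : ∀ i, pointIn (D i) S = e.symm i := fun i => pointIn_eq (hSD i)
  refine ⟨fun i => ⟨D i, hD i⟩, ⟨fun i => by rw [hSD i, Set.encard_singleton], fun i j hij => ?_,
    z, fun i => ?_, fun E => ?_⟩, ?_⟩
  · simp only [h6]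
    exact fun h => hij (e.symm.injective (Subtype.ext h))
  · simp only [h6]
    rw [h3 _ (e.symm i).2, h3 _ (e.symm 0).2]
  · simp only [h6]
    rw [h3 _ (e.symm 0).2]
    split_ifs with h
    · exact h4 _ (pointIn_mem h)
    · exact (h3 _ (e.symm 0).2).ge
  · ext p
    simp only [isolatedVertices, Finset.mem_image, Finset.mem_univ, true_and, h6]
    constructor
    · rintro ⟨i, rfl⟩
      exact (e.symm i).2
    · intro hp
      exact ⟨e ⟨p, hp⟩, by simp⟩

end Isolated

/-! ### The mean projection and its symmetries -/

section MeshProjection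

variable {H : Type*} [NormedAddCommGroup H] [InnerProductSpace ℝ H] [CompleteSpace H] {L : ℕ}

/-- The projection to the closed span of the columns that belong to the Delaunay triangles with
vertices in `S 0, …, S (L - 1)`. -/
noncomputable def meshProj (c : Finset Plane → H) (S : Fin L → Set Plane) : H →L[ℝ] H :=
  spanProj fun p : Columns S => c p.2.1

open Classical in
theorem image_mem_delaunay {S : Set Plane} {t : Finset Plane} (ht : t ∈ delaunay S)
    (g : Plane ≃ᵃⁱ[ℝ] Plane) : t.image g ∈ delaunay (g '' S) := by
  obtain ⟨h1, h2, z, r, h3, h4⟩ := ht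
  refine ⟨?_, ?_, g z, r, ?_, ?_⟩
  · rw [Finset.coe_image]
    exact Set.image_mono h1
  · rw [Finset.card_image_of_injective _ g.injective, h2]
  · intro p hp
    obtain ⟨q, hq, rfl⟩ := Finset.mem_image.1 hp
    rw [g.dist_map, h3 q hq]
  · rintro _ ⟨q, hq, rfl⟩
    rw [g.dist_map]
    exact h4 q hq

open Classical in
theorem meshProj_image {c : Finset Plane → H} (U : H ≃ₗᵢ[ℝ] H) (g : Plane ≃ᵃⁱ[ℝ] Plane)
    (hU : ∀ t, U (c t) = c (t.image g)) (S : Fin L → Set Plane) (x : H) :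
    meshProj c (fun l => g '' S l) (U x) = U (meshProj c S x) := by
  refine spanProj_map U ?_ ?_ x
  · rintro ⟨l, t, ht⟩
    exact ⟨⟨l, t.image g, image_mem_delaunay ht g⟩, hU t⟩
  · rintro ⟨l, t, ht⟩
    have h1 := image_mem_delaunay ht g.symm
    have h2 : g.symm '' (g '' S l) = S l := by
      rw [← Set.image_comp]
      simp
    rw [h2] at h1
    refine ⟨⟨l, _, h1⟩, (hU _).trans ?_⟩
    congr 1
    rw [Finset.image_image]
    have h3 : (g ∘ g.symm : Plane → Plane) = id := by
      ext1 p
      simp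
    rw [h3, Finset.image_id]

variable [SecondCountableTopology H] [MeasurableSpace H] [BorelSpace H] {c : Finset Plane → H}

open Classical in
/-- A measurable version of the projection to the span of the columns. -/
theorem exists_measurable_meshProj
    (hc : Measurable fun a : Fin 3 → Plane => c (Finset.univ.image a)) (x : H) :
    ∃ F : (Fin L → Set Plane) → H, Measurable F ∧
      ∀ S, (∀ l, LocallyFinite (S l)) → meshProj c S x = F S := by
  -- A family over a fixed countable index set with the same closed span: repeated triangles and the
  -- zero vectors at unused indices do not change it.
  let b : (Fin L → Set Plane) → Fin L × (Fin 3 → BasicSet) → H := fun S j =>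
    if IsolatesDelaunay j.2 (S j.1) then c (isolatedVertices j.2 (S j.1)) else 0
  refine ⟨fun S => spanProj (b S) x, measurable_spanProj (fun j => ?_) x, fun S hS => ?_⟩
  · refine Measurable.ite ?_ ?_ measurable_const
    · have h : Measurable fun S : Fin L → Set Plane => S j.1 := measurable_pi_apply j.1
      exact h (measurableSet_isolatesDelaunay j.2)
    · exact hc.comp (measurable_pi_lambda _ fun i =>
        (measurable_pointIn (measurableSet_basicSet (j.2 i))).comp (measurable_pi_apply j.1))
  · rw [meshProj]
    congr 1
    refine spanProj_congr ?_ ?_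
    · rintro ⟨l, t, ht⟩
      obtain ⟨D, hD, rfl⟩ := exists_isolatesDelaunay (hS l) ht
      have h1 : b S (l, D) = c (isolatedVertices D (S l)) := if_pos hD
      simp only
      rw [← h1]
      exact mem_closedSpan _ _
    · rintro ⟨l, D⟩
      by_cases hD : IsolatesDelaunay D (S l)
      · have h1 : b S (l, D) = c (isolatedVertices D (S l)) := if_pos hD
        rw [h1]
        exact mem_closedSpan (fun p : Columns S => c p.2.1) ⟨l, _, hD.mem_delaunay (hS l)⟩
      · have h1 : b S (l, D) = 0 := if_neg hD
        rw [h1]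
        exact Submodule.zero_mem _

variable {Ω : Type*} [MeasurableSpace Ω] {P : Measure Ω} [IsProbabilityMeasure P] {ρ : ℝ≥0}
  {X : Fin L → Ω → Set Plane}

theorem measurePreserving_affineIsometryEquiv (g : Plane ≃ᵃⁱ[ℝ] Plane) : MeasurePreserving g := by
  have h1 := (measurePreserving_add_right (volume : Measure Plane) (g 0)).comp
    g.linearIsometryEquiv.measurePreserving
  have h2 : (g : Plane → Plane) = (fun x => x + g 0) ∘ g.linearIsometryEquiv := by
    ext1 p
    have h3 : g (p +ᵥ (0 : Plane)) = _ := g.map_vadd (0 : Plane) (p : Plane)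
    simpa using h3
  rw [h2]
  exact h1

open Classical in
/-- The mean of the projections to the spans of the columns of random meshes. -/
theorem exists_mean_meshProj (hX : ∀ l, IsPoissonProcess P ρ (X l))
    (hind : IndependentProcesses P X)
    (hc : Measurable fun a : Fin 3 → Plane => c (Finset.univ.image a)) :
    ∃ T : H →L[ℝ] H,
      (∀ x, Integrable (fun ω => meshProj c (fun l => X l ω) x) P ∧
        T x = ∫ ω, meshProj c (fun l => X l ω) x ∂P) ∧
      (∀ x y, inner ℝ y (T x) = ∫ ω, inner ℝ y (meshProj c (fun l => X l ω) x) ∂P) ∧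
      (∀ x y, inner ℝ (T x) y = inner ℝ x (T y)) ∧
      ∀ (U : H ≃ₗᵢ[ℝ] H) (g : Plane ≃ᵃⁱ[ℝ] Plane), (∀ t, U (c t) = c (t.image g)) →
        ∀ x, T (U x) = U (T x) := by
  have hlf : ∀ᵐ ω ∂P, ∀ l, LocallyFinite (X l ω) := ae_all_iff.2 fun l => (hX l).ae_locallyFinite
  have hmX : Measurable fun ω l => X l ω := measurable_pi_lambda _ fun l => (hX l).measurable
  have hint : ∀ x, Integrable (fun ω => meshProj c (fun l => X l ω) x) P := by
    intro x
    obtain ⟨F, hF, hFS⟩ := exists_measurable_meshProj (L := L) hc x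
    refine Integrable.of_bound (C := ‖x‖) ?_ (ae_of_all _ fun ω => norm_spanProj_le _ x)
    refine ⟨fun ω => F fun l => X l ω, (hF.comp hmX).stronglyMeasurable, ?_⟩
    filter_upwards [hlf] with ω hω
    exact hFS _ hω
  let T : H →L[ℝ] H := LinearMap.mkContinuous
    { toFun := fun x => ∫ ω, meshProj c (fun l => X l ω) x ∂P
      map_add' := fun x y => by
        simp only [map_add]
        exact integral_add (hint x) (hint y)
      map_smul' := fun a x => by
        simp only [map_smul, RingHom.id_apply]
        exact integral_smul a _ } 1 (fun x => by
          have := norm_integral_le_of_norm_le_const (μ := P) (C := ‖x‖)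
            (ae_of_all P fun ω => norm_spanProj_le (fun p : Columns fun l => X l ω => c p.2.1) x)
          simpa [meshProj] using this)
  have hT : ∀ x, T x = ∫ ω, meshProj c (fun l => X l ω) x ∂P := fun x => rfl
  have hTi : ∀ x y, inner ℝ y (T x) = ∫ ω, inner ℝ y (meshProj c (fun l => X l ω) x) ∂P :=
    fun x y => by rw [hT, integral_inner (hint x)]
  refine ⟨T, fun x => ⟨hint x, hT x⟩, hTi, fun x y => ?_, fun U g hU x => ?_⟩
  · rw [real_inner_comm, hTi, hTi]
    congr 1
    ext1 ω
    rw [meshProj, real_inner_comm, inner_spanProj_left]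
  · obtain ⟨F, hF, hFS⟩ := exists_measurable_meshProj (L := L) hc (U x)
    obtain ⟨h1, h2, h3⟩ := map_image_joint hX hind (measurePreserving_affineIsometryEquiv g)
      g.injective
    -- Equality in law applies to the measurable version `F`; local finiteness, which the isometry
    -- preserves, allows passing between `F` and the projection.
    calc T (U x) = ∫ ω, F (fun l => X l ω) ∂P := by
          rw [hT]
          refine integral_congr_ae ?_
          filter_upwards [hlf] with ω hω
          exact hFS _ hω
      _ = ∫ S, F S ∂(P.map fun ω l => X l ω) :=
          (integral_map h1.aemeasurable hF.aestronglyMeasurable).symm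
      _ = ∫ ω, F (fun l => g '' X l ω) ∂P := by
          rw [← h3]
          exact integral_map h2.aemeasurable hF.aestronglyMeasurable
      _ = ∫ ω, U (meshProj c (fun l => X l ω) x) ∂P := by
          refine integral_congr_ae ?_
          filter_upwards [hlf] with ω hω
          rw [← meshProj_image U g hU]
          exact (hFS _ fun l => (hω l).image g).symm
      _ = U (T x) := by
          rw [hT]
          exact U.toContinuousLinearEquiv.toContinuousLinearMap.integral_comp_comm (hint x)

end MeshProjection

/-! ### Finite expected number of triangles near the origin -/

section Counting

/-- The Delaunay triangles that meet the disc of radius two about the origin. -/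
def centralTriangles (S : Set Plane) : Set (Finset Plane) :=
  {t ∈ delaunay S | (triangle t ∩ Metric.closedBall 0 2).Nonempty}

/-- The squares of side `r / 2` near the disc of radius `r + 2` about the origin. -/
noncomputable def nearCells : Finset (ℤ × ℤ) := Finset.Icc (-6) 6 ×ˢ Finset.Icc (-6) 6

theorem abs_apply_le_norm (p : Plane) (i : Fin 2) : |p i| ≤ ‖p‖ := by
  simpa using PiLp.norm_apply_le p i

theorem dist_lt_of_cell_eq {r : ℝ} (hr : 0 < r) {p q : Plane} (h : cell (2 / r) p = cell (2 / r) q) :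
    dist p q < r := by
  have h1 : ∀ i, |p i - q i| < r / 2 := by
    intro i
    have h2 : ⌊2 / r * p i⌋ = ⌊2 / r * q i⌋ := by
      fin_cases i
      · exact congrArg Prod.fst h
      · exact congrArg Prod.snd h
    have h3 := Int.abs_sub_lt_one_of_floor_eq_floor h2
    rw [← mul_sub, abs_mul, abs_of_pos (by positivity), div_mul_eq_mul_div, div_lt_one hr] at h3
    linarith
  rw [EuclideanSpace.dist_eq, Real.sqrt_lt' hr, Fin.sum_univ_two, Real.dist_eq, Real.dist_eq]
  have h2 := pow_lt_pow_left₀ (h1 0) (abs_nonneg _) two_ne_zero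
  have h3 := pow_lt_pow_left₀ (h1 1) (abs_nonneg _) two_ne_zero
  nlinarith [sq_nonneg r]

/-- A large Delaunay triangle near the origin forces an empty square. -/
theorem exists_empty_cell {S : Set Plane} {t : Finset Plane} (ht : t ∈ centralTriangles S) {r : ℝ}
    (hr : 1 ≤ r) (h : ¬ (t : Set Plane) ⊆ Metric.closedBall 0 (2 + 2 * r)) :
    ∃ z ∈ nearCells, S ∩ cell (2 / r) ⁻¹' {z} = ∅ := by
  obtain ⟨⟨h1, h2, c, R, h3, h4⟩, q, hq, hq2⟩ := ht
  have htri : triangle t ⊆ Metric.closedBall c R :=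
    convexHull_min (fun p hp => (h3 p hp).le) (convex_closedBall c R)
  have hqc : dist q c ≤ R := htri hq
  have hq2' : ‖q‖ ≤ 2 := by simpa using hq2
  -- Otherwise every vertex is within `2 * R ≤ 2 * r` of `q`, against `h`.
  have hrR : r < R := by
    by_contra hle
    push Not at hle
    refine h fun p hp => ?_
    have h5 := dist_triangle4 p c q 0
    rw [h3 p hp, dist_comm c q, dist_zero_right, dist_zero_right] at h5
    rw [mem_closedBall_zero_iff]
    linarith
  have hR : 0 < R := by linarith
  -- Moving `q` towards the circumcentre by at most `r` gives a point near the origin whose open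
  -- disc of radius `r` lies in the empty open circumdisc. The cell of `w` has diameter less than
  -- `r`, so it is empty as well.
  set w : Plane := q + (r / R) • (c - q)
  have hwq : ‖w - q‖ ≤ r := by
    have : w - q = (r / R) • (c - q) := by simp [w]
    rw [this, norm_smul, ← dist_eq_norm, dist_comm, Real.norm_of_nonneg (by positivity)]
    calc r / R * dist q c ≤ r / R * R := by gcongr
      _ = r := by field_simp
  have hwc : dist w c ≤ R - r := by
    have : w - c = (1 - r / R) • (q - c) := by
      simp only [w]
      module
    have h0 : 0 ≤ 1 - r / R := by
      rw [sub_nonneg, div_le_one hR]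
      exact hrR.le
    rw [dist_eq_norm, this, norm_smul, Real.norm_of_nonneg h0, ← dist_eq_norm]
    calc (1 - r / R) * dist q c ≤ (1 - r / R) * R := by gcongr
      _ = R - r := by field_simp
  have hw : ‖w‖ ≤ 2 + r := by
    have := norm_add_le (w - q) q
    rw [sub_add_cancel] at this
    linarith
  -- The bound is `(2 / r) * (2 + r) = 2 + 4 / r ≤ 6`, as `1 ≤ r`.
  have hcoord : ∀ i, ⌊2 / r * w i⌋ ∈ Finset.Icc (-6 : ℤ) 6 := by
    intro i
    have h5 : |2 / r * w i| ≤ 6 := by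
      rw [abs_mul, abs_of_pos (by positivity), div_mul_eq_mul_div, div_le_iff₀ (by linarith)]
      have := (abs_apply_le_norm w i).trans hw
      linarith
    rw [abs_le] at h5
    rw [Finset.mem_Icc]
    constructor
    · rw [Int.le_floor]
      exact_mod_cast h5.1
    · have := (Int.floor_le (2 / r * w i)).trans h5.2
      exact_mod_cast this
  refine ⟨cell (2 / r) w, Finset.mem_product.2 ⟨hcoord 0, hcoord 1⟩, ?_⟩
  rw [Set.eq_empty_iff_forall_notMem]
  rintro p ⟨hp, hpw⟩
  have h5 := dist_lt_of_cell_eq (by linarith : 0 < r) hpw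
  have h6 := h4 p hp
  have h7 := dist_triangle p w c
  linarith

open Classical in
/-- The number of three-element subsets of a set with `n` elements. -/
noncomputable def triples (n : ℕ∞) : ℝ≥0∞ := if n = ⊤ then ⊤ else (n.toNat.choose 3 : ℕ)

@[simp] theorem triples_natCast (n : ℕ) : triples n = (n.choose 3 : ℕ) := by simp [triples]

theorem encard_triples_le (A : Set Plane) :
    (({t : Finset Plane | (t : Set Plane) ⊆ A ∧ t.card = 3}.encard : ℕ∞) : ℝ≥0∞) ≤
      triples A.encard := by
  by_cases hA : A.Finite
  · have h1 : {t : Finset Plane | (t : Set Plane) ⊆ A ∧ t.card = 3} =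
        ((hA.toFinset.powersetCard 3 : Finset (Finset Plane)) : Set (Finset Plane)) := by
      ext t
      simp [Finset.mem_powersetCard, ← Finset.coe_subset]
    rw [h1, Set.encard_coe_eq_coe_finsetCard, Finset.card_powersetCard, hA.encard_eq_coe_toFinset_card,
      triples_natCast]
    simp
  · rw [Set.Infinite.encard_eq hA]
    simp [triples]

/-- The event that near the origin there is an empty square of side `k / 2`; it is vacuous for
`k = 0`. -/
def HasVoid (k : ℕ) (S : Set Plane) : Prop :=
  k = 0 ∨ ∃ z ∈ nearCells, S ∩ cell (2 / k) ⁻¹' {z} = ∅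

-- Sort the triangles by the least `k` for which the disc of radius `2 + 2 * (k + 1)` contains the
-- vertices. If `k` is positive, minimality says that the disc of radius `2 + 2 * k` does not
-- contain them, and `exists_empty_cell` with `r = k` yields the void.
open Classical in
theorem encard_centralTriangles_le (S : Set Plane) :
    (((centralTriangles S).encard : ℕ∞) : ℝ≥0∞) ≤
      ∑' k : ℕ, if HasVoid k S then
        triples (S ∩ Metric.closedBall 0 (2 + 2 * ((k : ℝ) + 1))).encard else 0 := by
  let M : ℕ → Set (Finset Plane) := fun k => {t | HasVoid k S ∧
    ((t : Set Plane) ⊆ S ∩ Metric.closedBall 0 (2 + 2 * ((k : ℝ) + 1)) ∧ t.card = 3)}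
  have hsub : centralTriangles S ⊆ ⋃ k, M k := by
    intro t ht
    have hex : ∃ k : ℕ, (t : Set Plane) ⊆ Metric.closedBall 0 (2 + 2 * ((k : ℝ) + 1)) := by
      obtain ⟨r, hr⟩ := t.finite_toSet.isBounded.subset_closedBall 0
      obtain ⟨n, hn⟩ := exists_nat_ge r
      refine ⟨n, hr.trans (Metric.closedBall_subset_closedBall ?_)⟩
      have : (0 : ℝ) ≤ n := n.cast_nonneg
      linarith
    refine Set.mem_iUnion.2 ⟨Nat.find hex, ?_, Set.subset_inter ht.1.1 (Nat.find_spec hex), ht.1.2.1⟩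
    rcases Nat.eq_zero_or_eq_succ_pred (Nat.find hex) with h0 | h0
    · exact Or.inl h0
    · right
      refine exists_empty_cell ht ?_ ?_
      · rw [h0]
        push_cast
        have : (0 : ℝ) ≤ (Nat.find hex).pred := Nat.cast_nonneg _
        linarith
      · have h1 := Nat.find_min hex (m := (Nat.find hex).pred) (by omega)
        have h2 : (((Nat.find hex).pred : ℕ) : ℝ) + 1 = (Nat.find hex : ℕ) := by
          conv_rhs => rw [h0]
          push_cast
          rfl
        rwa [h2] at h1
  let _ : MeasurableSpace (Finset Plane) := ⊤
  have hc : ∀ A : Set (Finset Plane), ((A.encard : ℕ∞) : ℝ≥0∞) = Measure.count A := fun A => by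
    rw [Measure.count_apply (MeasurableSpace.measurableSet_top)]
  rw [hc]
  refine (measure_mono hsub).trans ((measure_iUnion_le _).trans (ENNReal.tsum_le_tsum fun k => ?_))
  rw [← hc]
  split_ifs with h
  · refine le_trans ?_ (encard_triples_le _)
    exact ENat.toENNReal_mono (Set.encard_le_encard fun t ht => ht.2)
  · have : M k = ∅ := by
      ext t
      simp [M, h]
    simp [this]

/-- The third factorial moment of the Poisson law is `r ^ 3`: after a shift of the index by three,
the weights are Poisson weights times `r ^ 3 / 6`. The factor `1 / 6` is dropped. -/
theorem lintegral_triples_poissonMeasure (r : ℝ≥0) :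
    ∫⁻ n : ℕ, triples n ∂(poissonMeasure r) ≤ ENNReal.ofReal ((r : ℝ) ^ 3) := by
  rw [lintegral_countable']
  have hinj : Function.Injective fun n : ℕ => n + 3 := add_left_injective 3
  rw [← hinj.tsum_eq]
  · have h1 : ∀ n : ℕ, triples ((n + 3 : ℕ) : ℕ∞) * poissonMeasure r {n + 3} ≤
        ENNReal.ofReal ((r : ℝ) ^ 3) * poissonMeasure r {n} := by
      intro n
      rw [triples_natCast, poissonMeasure_singleton, poissonMeasure_singleton,
        ← ENNReal.ofReal_natCast, ← ENNReal.ofReal_mul (by positivity),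
        ← ENNReal.ofReal_mul (by positivity)]
      refine ENNReal.ofReal_le_ofReal ?_
      have h2 : ((n + 3).choose 3 : ℝ) * n.factorial * 6 = (n + 3).factorial := by
        have h := Nat.choose_mul_factorial_mul_factorial (show 3 ≤ n + 3 by omega)
        rw [Nat.add_sub_cancel, show (3 : ℕ).factorial = 6 from rfl] at h
        rw [← h]
        push_cast
        ring
      have h3 : (0 : ℝ) < n.factorial := by exact_mod_cast n.factorial_pos
      have h4 : (0 : ℝ) < (n + 3).factorial := by exact_mod_cast (n + 3).factorial_pos
      rw [← mul_div_assoc, ← mul_div_assoc, div_le_div_iff₀ h4 h3, ← h2]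
      have h5 : (0 : ℝ) ≤ ((n + 3).choose 3 : ℝ) * n.factorial * (Real.exp (-r) * r ^ (n + 3)) := by
        positivity
      rw [pow_add] at h5 ⊢
      linarith
    calc ∑' n : ℕ, triples ((n + 3 : ℕ) : ℕ∞) * poissonMeasure r {n + 3}
        ≤ ∑' n : ℕ, ENNReal.ofReal ((r : ℝ) ^ 3) * poissonMeasure r {n} := ENNReal.tsum_le_tsum h1
      _ = ∫⁻ _ : ℕ, ENNReal.ofReal ((r : ℝ) ^ 3) ∂(poissonMeasure r) := by
        rw [lintegral_countable']
      _ = ENNReal.ofReal ((r : ℝ) ^ 3) := by simp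
  · intro n hn
    by_contra hlt
    have h6 : n < 3 := by
      by_contra h
      exact hlt ⟨n - 3, by simp only; omega⟩
    refine hn ?_
    simp only [triples_natCast]
    rw [Nat.choose_eq_zero_of_lt h6]
    simp

variable {Ω : Type*} [MeasurableSpace Ω] {P : Measure Ω} {ρ : ℝ≥0} {X : Ω → Set Plane}

theorem IsPoissonProcess.lintegral_triples_le (hX : IsPoissonProcess P ρ X) {A : Set Plane}
    (hA : MeasurableSet A) {R : ℝ} (hR : 0 ≤ R) (hAR : A ⊆ Metric.closedBall 0 R) :
    ∫⁻ ω, triples (X ω ∩ A).encard ∂P ≤ ENNReal.ofReal ((ρ * (Real.pi * R ^ 2)) ^ 3) := by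
  have hvol : volume A ≤ ENNReal.ofReal (Real.pi * R ^ 2) := by
    refine (measure_mono hAR).trans ?_
    rw [EuclideanSpace.volume_closedBall_fin_two, mul_comm, ENNReal.ofReal_mul Real.pi_pos.le,
      ENNReal.ofReal_pow hR]
  have hfin : volume A ≠ ∞ := ne_top_of_le_ne_top ENNReal.ofReal_ne_top hvol
  calc ∫⁻ ω, triples (X ω ∩ A).encard ∂P
      = ∫⁻ n, triples n ∂(P.map fun ω => (X ω ∩ A).encard) :=
        (lintegral_map (Measurable.of_discrete) (hX.measurable_count hA)).symm
    _ = ∫⁻ n : ℕ, triples n ∂(poissonMeasure (ρ * (volume A).toNNReal)) := by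
        rw [hX.count_law A hA hfin, lintegral_map Measurable.of_discrete Measurable.of_discrete]
    _ ≤ _ := (lintegral_triples_poissonMeasure _).trans (ENNReal.ofReal_le_ofReal ?_)
  push_cast
  gcongr
  exact ENNReal.toReal_le_of_le_ofReal (by positivity) hvol

theorem IsPoissonProcess.measure_void (hX : IsPoissonProcess P ρ X) {A : Set Plane}
    (hA : MeasurableSet A) (hA' : volume A ≠ ∞) :
    P {ω | X ω ∩ A = ∅} = ENNReal.ofReal (Real.exp (-(ρ * (volume A).toReal))) := by
  have h1 : {ω | X ω ∩ A = ∅} = (fun ω => (X ω ∩ A).encard) ⁻¹' {0} := by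
    ext ω; simp
  have h2 : ((fun n : ℕ => (n : ℕ∞)) ⁻¹' {0}) = {0} := by
    ext n; simp
  rw [h1, ← Measure.map_apply (hX.measurable_count hA) (measurableSet_singleton _),
    hX.count_law A hA hA', Measure.map_apply Measurable.of_discrete (measurableSet_singleton _),
    h2, poissonMeasure_singleton]
  simp [ENNReal.toReal]

-- If `A` is void, the points in `B` are those in `B \ A`, whose number is independent of the event;
-- the expectation therefore factors.
open Classical in
theorem IsPoissonProcess.lintegral_void_triples_le (hX : IsPoissonProcess P ρ X) {A B : Set Plane}
    (hA : MeasurableSet A) (hA' : volume A ≠ ∞) (hB : MeasurableSet B) {R : ℝ} (hR : 0 ≤ R)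
    (hBR : B ⊆ Metric.closedBall 0 R) :
    ∫⁻ ω, (if X ω ∩ A = ∅ then triples (X ω ∩ B).encard else 0) ∂P ≤
      ENNReal.ofReal (Real.exp (-(ρ * (volume A).toReal)) * (ρ * (Real.pi * R ^ 2)) ^ 3) := by
  have hdisj : Pairwise fun i j => Disjoint ((![A, B \ A] : Fin 2 → Set Plane) i)
      ((![A, B \ A] : Fin 2 → Set Plane) j) := by
    intro i j hij
    fin_cases i <;> fin_cases j <;> simp_all [Set.disjoint_sdiff_left, Set.disjoint_sdiff_right]
  have hind := (hX.count_indep 2 ![A, B \ A] (by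
    intro i
    fin_cases i
    · exact hA
    · exact hB.diff hA) hdisj).indepFun (i := 0) (j := 1) (by simp)
  have hind' : IndepFun (fun ω => if X ω ∩ A = ∅ then (1 : ℝ≥0∞) else 0)
      (fun ω => triples (X ω ∩ (B \ A)).encard) P := by
    have := hind.comp (φ := fun n : ℕ∞ => if n = 0 then (1 : ℝ≥0∞) else 0) (ψ := triples)
      Measurable.of_discrete Measurable.of_discrete
    simpa [Function.comp_def] using this
  have hm : MeasurableSet {ω | X ω ∩ A = ∅} := hX.measurable (measurableSet_void hA)
  calc ∫⁻ ω, (if X ω ∩ A = ∅ then triples (X ω ∩ B).encard else 0) ∂P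
      = ∫⁻ ω, ((fun ω => if X ω ∩ A = ∅ then (1 : ℝ≥0∞) else 0) *
          fun ω => triples (X ω ∩ (B \ A)).encard) ω ∂P := by
        refine lintegral_congr fun ω => ?_
        by_cases h : X ω ∩ A = ∅
        · have : X ω ∩ (B \ A) = X ω ∩ B := by
            ext p
            constructor
            · exact fun hp => ⟨hp.1, hp.2.1⟩
            · refine fun hp => ⟨hp.1, hp.2, fun hpA => ?_⟩
              have : p ∈ X ω ∩ A := ⟨hp.1, hpA⟩
              simp [h] at this
          simp [h, this]
        · simp [h]
    _ = (∫⁻ ω, (if X ω ∩ A = ∅ then (1 : ℝ≥0∞) else 0) ∂P) *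
          ∫⁻ ω, triples (X ω ∩ (B \ A)).encard ∂P :=
        lintegral_mul_eq_lintegral_mul_lintegral_of_indepFun
          (Measurable.ite hm measurable_const measurable_const)
          ((Measurable.of_discrete (f := triples)).comp (hX.measurable_count (hB.diff hA))) hind'
    _ ≤ ENNReal.ofReal (Real.exp (-(ρ * (volume A).toReal))) *
          ENNReal.ofReal ((ρ * (Real.pi * R ^ 2)) ^ 3) := by
        gcongr
        · have : (fun ω => if X ω ∩ A = ∅ then (1 : ℝ≥0∞) else 0) =
              Set.indicator {ω | X ω ∩ A = ∅} 1 := by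
            ext ω
            simp [Set.indicator_apply]
          rw [this, lintegral_indicator_one hm, hX.measure_void hA hA']
        · exact hX.lintegral_triples_le (hB.diff hA) hR (Set.sdiff_subset.trans hBR)
    _ = _ := (ENNReal.ofReal_mul (Real.exp_pos _).le).symm

open Classical in
/-- The expected number of Delaunay triangles near the origin is finite. -/
theorem IsPoissonProcess.exists_bound_centralTriangles (hX : IsPoissonProcess P ρ X) (hρ : 0 < ρ) :
    ∃ F : Ω → ℝ≥0∞, Measurable F ∧
      (∀ ω, (((centralTriangles (X ω)).encard : ℕ∞) : ℝ≥0∞) ≤ F ω) ∧ ∫⁻ ω, F ω ∂P ≠ ∞ := by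
  let B : ℕ → Set Plane := fun k => Metric.closedBall 0 (2 + 2 * ((k : ℝ) + 1))
  have hB : ∀ k, MeasurableSet (B k) := fun k => Metric.isClosed_closedBall.measurableSet
  have hmv : ∀ k, MeasurableSet {ω | HasVoid k (X ω)} := by
    intro k
    have : {ω | HasVoid k (X ω)} = {_ω | k = 0} ∪
        ⋃ z ∈ nearCells, {ω | X ω ∩ cell (2 / k) ⁻¹' {z} = ∅} := by
      ext ω
      simp [HasVoid]
    rw [this]
    exact (MeasurableSet.const _).union (Finset.measurableSet_biUnion _ fun z _ =>
      hX.measurable (measurableSet_void (measurableSet_cell _ _)))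
  have hmt : ∀ k, Measurable fun ω => triples (X ω ∩ B k).encard := fun k =>
    (Measurable.of_discrete (f := triples)).comp (hX.measurable_count (hB k))
  have hm : ∀ k, Measurable fun ω => if HasVoid k (X ω) then triples (X ω ∩ B k).encard else 0 :=
    fun k => Measurable.ite (hmv k) (hmt k) measurable_const
  refine ⟨fun ω => ∑' k, if HasVoid k (X ω) then triples (X ω ∩ B k).encard else 0,
    Measurable.tsum hm, fun ω => encard_centralTriangles_le (X ω), ?_⟩
  rw [lintegral_tsum fun k => (hm k).aemeasurable]
  -- The factors come from the union bound over the cells and from `2 + 2 * (r + 1) ≤ 6 * r` for `1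
  -- ≤ r`, raised to the sixth power.
  set C : ℝ := nearCells.card * (ρ * Real.pi) ^ 3 * 6 ^ 6
  have hterm : ∀ k : ℕ, ∫⁻ ω, (if HasVoid (k + 1) (X ω) then
      triples (X ω ∩ B (k + 1)).encard else 0) ∂P ≤
      ENNReal.ofReal (C * (((k + 1 : ℕ) : ℝ) ^ 6 * Real.exp (-(ρ / 4 : ℝ) * (k + 1 : ℕ)))) := by
    intro k
    set r : ℝ := ((k + 1 : ℕ) : ℝ) with hr
    have hr1 : 1 ≤ r := by rw [hr]; exact_mod_cast Nat.le_add_left 1 k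
    have hr0 : 0 < r := by linarith
    have hvol : ∀ z, (volume (cell (2 / r) ⁻¹' {z})).toReal = r ^ 2 / 4 := by
      intro z
      rw [volume_cell (by positivity), ENNReal.toReal_ofReal (by positivity)]
      field_simp
      norm_num
    have hvol' : ∀ z, volume (cell (2 / r) ⁻¹' {z}) ≠ ∞ := by
      intro z
      rw [volume_cell (by positivity)]
      exact ENNReal.ofReal_ne_top
    calc ∫⁻ ω, (if HasVoid (k + 1) (X ω) then triples (X ω ∩ B (k + 1)).encard else 0) ∂P
        ≤ ∫⁻ ω, ∑ z ∈ nearCells, (if X ω ∩ cell (2 / r) ⁻¹' {z} = ∅ then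
            triples (X ω ∩ B (k + 1)).encard else 0) ∂P := by
          refine lintegral_mono fun ω => ?_
          simp only
          split_ifs with h
          · rcases h with h | ⟨z, hz, h⟩
            · omega
            · refine le_trans ?_ (Finset.single_le_sum (fun _ _ => zero_le) hz)
              rw [if_pos h]
          · exact zero_le
      _ = ∑ z ∈ nearCells, ∫⁻ ω, (if X ω ∩ cell (2 / r) ⁻¹' {z} = ∅ then
            triples (X ω ∩ B (k + 1)).encard else 0) ∂P :=
          lintegral_finsetSum _ fun z _ => Measurable.ite
            (hX.measurable (measurableSet_void (measurableSet_cell _ _))) (hmt _) measurable_const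
      _ ≤ ∑ z ∈ nearCells, ENNReal.ofReal (Real.exp (-(ρ * (r ^ 2 / 4))) *
            (ρ * (Real.pi * (2 + 2 * (r + 1)) ^ 2)) ^ 3) := by
          refine Finset.sum_le_sum fun z _ => ?_
          have := hX.lintegral_void_triples_le (measurableSet_cell (2 / r) z) (hvol' z)
            (hB (k + 1)) (R := 2 + 2 * (r + 1)) (by positivity) le_rfl
          rwa [hvol] at this
      _ = ENNReal.ofReal (nearCells.card * (Real.exp (-(ρ * (r ^ 2 / 4))) *
            (ρ * (Real.pi * (2 + 2 * (r + 1)) ^ 2)) ^ 3)) := by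
          rw [Finset.sum_const, nsmul_eq_mul, ENNReal.ofReal_mul (Nat.cast_nonneg _),
            ENNReal.ofReal_natCast]
      _ ≤ _ := by
          refine ENNReal.ofReal_le_ofReal ?_
          -- Since `r ≤ r ^ 2`, the Gaussian factor is weakened to an exponential one, which still
          -- beats `r ^ 6`.
          have h1 : Real.exp (-(ρ * (r ^ 2 / 4))) ≤ Real.exp (-(ρ / 4 : ℝ) * r) := by
            rw [Real.exp_le_exp]
            have : (0 : ℝ) ≤ ρ * (r * (r - 1)) :=
              mul_nonneg ρ.2 (mul_nonneg hr0.le (sub_nonneg.2 hr1))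
            nlinarith
          have h2 : (ρ * (Real.pi * (2 + 2 * (r + 1)) ^ 2)) ^ 3 ≤ (ρ * Real.pi) ^ 3 * 6 ^ 6 * r ^ 6 := by
            calc (ρ * (Real.pi * (2 + 2 * (r + 1)) ^ 2)) ^ 3
                ≤ (ρ * (Real.pi * (6 * r) ^ 2)) ^ 3 := by
                  gcongr
                  linarith
              _ = _ := by ring
          calc _ ≤ (nearCells.card : ℝ) * (Real.exp (-(ρ / 4 : ℝ) * r) *
                ((ρ * Real.pi) ^ 3 * 6 ^ 6 * r ^ 6)) := by gcongr
            _ = _ := by simp only [C]; ring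
  have hsum : Summable fun k : ℕ =>
      C * (((k + 1 : ℕ) : ℝ) ^ 6 * Real.exp (-(ρ / 4 : ℝ) * (k + 1 : ℕ))) := by
    refine Summable.mul_left _ ?_
    have h1 := Real.summable_pow_mul_exp_neg_nat_mul 6
      (show (0 : ℝ) < ρ / 4 by positivity)
    exact (summable_nat_add_iff 1).2 h1
  -- The term `k = 0` carries no void factor and is bounded separately.
  rw [tsum_eq_zero_add' ENNReal.summable]
  refine ENNReal.add_ne_top.2 ⟨?_, ?_⟩
  · refine ne_top_of_le_ne_top ENNReal.ofReal_ne_top (le_trans (lintegral_mono fun ω => ?_)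
      (hX.lintegral_triples_le (hB 0) (R := 2 + 2 * (((0 : ℕ) : ℝ) + 1)) (by positivity) le_rfl))
    simp only
    split_ifs
    · exact le_rfl
    · exact zero_le
  · exact ne_top_of_le_ne_top hsum.tsum_ofReal_ne_top (ENNReal.tsum_le_tsum hterm)

end Counting

/-! ### Dependence of a triangle on its vertices -/

section Triangles

open Classical in
theorem triangle_image (t : Finset Plane) (g : Plane ≃ᵃⁱ[ℝ] Plane) :
    triangle (t.image g) = g '' triangle t := by
  rw [triangle, triangle, Finset.coe_image]
  exact (g.toAffineEquiv.toAffineMap.image_convexHull (t : Set Plane)).symm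

open Classical in
theorem mem_triangle_iff (a : Fin 3 → Plane) (v : Plane) :
    v ∈ triangle (Finset.univ.image a) ↔ ∃ w ∈ stdSimplex ℝ (Fin 3), ∑ i, w i • a i = v := by
  have h := (Fintype.linearCombination ℝ a).image_convexHull
    (Set.range fun i j : Fin 3 => if i = j then (1 : ℝ) else 0)
  rw [convexHull_basis_eq_stdSimplex, ← Set.range_comp] at h
  have h2 : (Fintype.linearCombination ℝ a ∘ fun i j : Fin 3 => if i = j then (1 : ℝ) else 0) = a := by
    ext1 i
    simp [Fintype.linearCombination_apply]
  rw [h2] at h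
  rw [triangle, Finset.coe_image, Finset.coe_univ, Set.image_univ, ← h]
  rfl

-- This is the projection of a closed set along the compact simplex of barycentric weights, so it
-- includes degenerate triples. It makes the columns measurable functions of the vertices.
open Classical in
theorem isClosed_mem_triangle :
    IsClosed {q : (Fin 3 → Plane) × Plane | q.2 ∈ triangle (Finset.univ.image q.1)} := by
  have : {q : (Fin 3 → Plane) × Plane | q.2 ∈ triangle (Finset.univ.image q.1)} =
      Prod.fst '' {r : ((Fin 3 → Plane) × Plane) × stdSimplex ℝ (Fin 3) |
        ∑ i, (r.2 : Fin 3 → ℝ) i • r.1.1 i = r.1.2} := by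
    ext ⟨a, v⟩
    rw [Set.mem_ofPred_eq, mem_triangle_iff]
    constructor
    · rintro ⟨w, hw, h⟩
      exact ⟨((a, v), ⟨w, hw⟩), h, rfl⟩
    · rintro ⟨⟨q, w⟩, h, rfl⟩
      exact ⟨w, w.2, h⟩
  rw [this]
  have : CompactSpace (stdSimplex ℝ (Fin 3)) :=
    isCompact_iff_compactSpace.1 (isCompact_stdSimplex ℝ (Fin 3))
  exact isClosedMap_fst_of_compactSpace _ (isClosed_eq (continuous_finsetSum _ fun i _ =>
    (((continuous_apply i).comp (continuous_subtype_val.comp continuous_snd)).smul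
      ((continuous_apply i).comp (continuous_fst.comp continuous_fst)))) (by fun_prop))

end Triangles

/-! ### Pixel images -/

section Discrete

/-- The set of pixels in a triangle, as an image. -/
noncomputable def pixelTriangle (t : Finset Plane) : PixelImage :=
  ⟨(pixel ⁻¹' triangle t).indicator (fun _ => (1 : ℝ)),
    (memℓp_zero ((finite_pixels t).subset fun u hu => by
      by_contra h
      exact hu (Set.indicator_of_notMem h _))).of_exponent_ge (zero_le (a := (2 : ℝ≥0∞)))⟩

open Classical in
theorem pixelTriangle_apply (t : Finset Plane) (u : ℤ × ℤ) :
    pixelTriangle t u = if pixel u ∈ triangle t then 1 else 0 := by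
  change (pixel ⁻¹' triangle t).indicator (fun _ => (1 : ℝ)) u = _
  rw [Set.indicator_apply]
  rfl

theorem pixelReconstruction_eq {L : ℕ} (S : Fin L → Set Plane) (x : PixelImage) :
    pixelReconstruction S x = meshProj pixelTriangle S x :=
  pinvTranspose_transposeApply _ _

instance : SecondCountableTopology PixelImage := by
  have h : TopologicalSpace.IsSeparable (Set.univ : Set PixelImage) := by
    have h1 : TopologicalSpace.IsSeparable
        (closure (Submodule.span ℝ (Set.range fun u : ℤ × ℤ => lp.single 2 u (1 : ℝ)) :
          Set PixelImage)) :=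
      ((Set.countable_range _).isSeparable.span (R := ℝ)).closure
    refine h1.mono fun f _ => ?_
    refine mem_closure_of_tendsto (lp.hasSum_single (by simp) f) (Eventually.of_forall fun s => ?_)
    refine Submodule.sum_mem _ fun u _ => ?_
    have : lp.single 2 u (f u) = f u • (lp.single 2 u (1 : ℝ) : PixelImage) := by
      rw [← lp.single_smul, smul_eq_mul, mul_one]
    rw [this]
    exact Submodule.smul_mem _ _ (Submodule.subset_span ⟨u, rfl⟩)
  have := TopologicalSpace.isSeparable_univ_iff.1 h
  exact UniformSpace.secondCountable_of_separable _

open Classical in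
theorem measurable_pixelTriangle [MeasurableSpace PixelImage] [BorelSpace PixelImage] :
    Measurable fun a : Fin 3 → Plane => pixelTriangle (Finset.univ.image a) := by
  refine measurable_of_inner fun y => ?_
  simp only [lp.inner_eq_tsum, pixelTriangle_apply]
  refine Measurable.tsum fun u => Measurable.inner measurable_const ?_
  refine Measurable.ite ?_ measurable_const measurable_const
  have h : Continuous fun a : Fin 3 → Plane => (a, pixel u) := by fun_prop
  exact (isClosed_mem_triangle.preimage h).measurableSet

/-- Permuting the pixels of an image. -/
noncomputable def permPixels (e : ℤ × ℤ ≃ ℤ × ℤ) : PixelImage ≃ₗᵢ[ℝ] PixelImage where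
  toFun f := ⟨fun u => f (e.symm u), by
    have h := (memℓp_gen_iff (by simp)).1 f.2
    exact memℓp_gen ((e.symm.summable_iff (f := fun u => ‖f u‖ ^ (2 : ℝ≥0∞).toReal)).2 h)⟩
  invFun f := ⟨fun u => f (e u), by
    have h := (memℓp_gen_iff (by simp)).1 f.2
    exact memℓp_gen ((e.summable_iff (f := fun u => ‖f u‖ ^ (2 : ℝ≥0∞).toReal)).2 h)⟩
  left_inv f := by
    ext u
    change f (e.symm (e u)) = f u
    rw [e.symm_apply_apply]
  right_inv f := by
    ext u
    change f (e (e.symm u)) = f u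
    rw [e.apply_symm_apply]
  map_add' f g := rfl
  map_smul' a f := rfl
  norm_map' f := by
    rw [lp.norm_eq_tsum_rpow (by simp), lp.norm_eq_tsum_rpow (by simp)]
    congr 1
    exact e.symm.tsum_eq fun u => ‖f u‖ ^ (2 : ℝ≥0∞).toReal

theorem permPixels_apply (e : ℤ × ℤ ≃ ℤ × ℤ) (f : PixelImage) (u : ℤ × ℤ) :
    permPixels e f u = f (e.symm u) := rfl

theorem permPixels_single (e : ℤ × ℤ ≃ ℤ × ℤ) (u : ℤ × ℤ) :
    permPixels e (lp.single 2 u (1 : ℝ)) = lp.single 2 (e u) (1 : ℝ) := by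
  ext v
  rw [permPixels_apply, lp.single_apply, lp.single_apply]
  by_cases h : v = e u
  · subst h; simp
  · have : e.symm v ≠ u := fun h' => h (by rw [← h', e.apply_symm_apply])
    simp [h, this]

open Classical in
theorem permPixels_pixelTriangle {e : ℤ × ℤ ≃ ℤ × ℤ} {g : Plane ≃ᵃⁱ[ℝ] Plane}
    (h : ∀ u, g (pixel u) = pixel (e u)) (t : Finset Plane) :
    permPixels e (pixelTriangle t) = pixelTriangle (t.image g) := by
  ext u
  rw [permPixels_apply, pixelTriangle_apply, pixelTriangle_apply, triangle_image]
  have h1 : pixel u = g (pixel (e.symm u)) := by rw [h, e.apply_symm_apply]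
  rw [h1, g.injective.mem_set_image]

theorem pixel_injective : Function.Injective pixel := by
  intro u v h
  have h0 := congrFun (congrArg (fun p : Plane => (p : Fin 2 → ℝ)) h) 0
  have h1 := congrFun (congrArg (fun p : Plane => (p : Fin 2 → ℝ)) h) 1
  simp only [pixel] at h0 h1
  exact Prod.ext (by simpa using h0) (by simpa using h1)

theorem pixel_add (u v : ℤ × ℤ) : pixel (u + v) = pixel u + pixel v := by
  ext i
  fin_cases i <;> simp [pixel]

theorem finite_pixels_norm (r : ℝ) : {u : ℤ × ℤ | ‖pixel u‖ = r}.Finite := by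
  refine (((Set.finite_Icc (-⌈r⌉) ⌈r⌉).prod (Set.finite_Icc (-⌈r⌉) ⌈r⌉))).subset ?_
  intro u hu
  have h : ‖pixel u‖ ≤ r := le_of_eq hu
  have h0 : |(u.1 : ℝ)| ≤ ⌈r⌉ := by
    simpa [pixel] using ((abs_apply_le_norm (pixel u) 0).trans h).trans (Int.le_ceil r)
  have h1 : |(u.2 : ℝ)| ≤ ⌈r⌉ := by
    simpa [pixel] using ((abs_apply_le_norm (pixel u) 1).trans h).trans (Int.le_ceil r)
  rw [abs_le] at h0 h1
  exact ⟨⟨by exact_mod_cast h0.1, by exact_mod_cast h0.2⟩,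
    ⟨by exact_mod_cast h1.1, by exact_mod_cast h1.2⟩⟩

/-- An isometry that maps the pixel grid into itself permutes the pixels. -/
theorem exists_perm_pixels (R : Plane ≃ₗᵢ[ℝ] Plane)
    (hR : ∀ w, ∃ w', R (pixel w) = pixel w') :
    ∃ e : ℤ × ℤ ≃ ℤ × ℤ, ∀ w, R (pixel w) = pixel (e w) := by
  choose f hf using hR
  have hinj : Function.Injective f := by
    intro u v h
    apply pixel_injective
    apply R.injective
    rw [hf, hf, h]
  have hsurj : Function.Surjective f := by
    intro u
    -- Each circle about the origin holds finitely many pixels, and an injective self-map of a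
    -- finite set is onto.
    have hmaps : Set.MapsTo f {w | ‖pixel w‖ = ‖pixel u‖} {w | ‖pixel w‖ = ‖pixel u‖} := by
      intro w hw
      change ‖pixel (f w)‖ = ‖pixel u‖
      rw [← hf, R.norm_map]
      exact hw
    have himg := Set.eq_of_subset_of_ncard_le hmaps.image_subset
      (Set.ncard_image_of_injective _ hinj).ge (finite_pixels_norm _)
    obtain ⟨w, -, hw⟩ : u ∈ f '' {w | ‖pixel w‖ = ‖pixel u‖} := by
      rw [himg]
      rfl
    exact ⟨w, hw⟩
  exact ⟨Equiv.ofBijective f ⟨hinj, hsurj⟩, hf⟩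

variable {Ω : Type*} [MeasurableSpace Ω] {P : Measure Ω} [IsProbabilityMeasure P] {L : ℕ}
  {ρ : ℝ≥0} {X : Fin L → Ω → Set Plane}

/-- With the kernel `T δ₀`, self-adjointness gives `(T x) u = ⟨T δᵤ, x⟩`, and `T δᵤ` is a translate
of `T δ₀`. An isometry of the grid that fixes the origin fixes `δ₀`, hence also `T δ₀`. -/
theorem exists_pixel_kernel (hX : ∀ l, IsPoissonProcess P ρ (X l))
    (hind : IndependentProcesses P X) :
    ∃ κ : ℤ × ℤ → ℝ,
      (∀ x : PixelImage,
        Integrable (fun ω => pixelReconstruction (fun l => X l ω) x) P ∧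
        ∀ u : ℤ × ℤ, HasSum (fun v => x v * κ (u - v))
          ((∫ ω, pixelReconstruction (fun l => X l ω) x ∂P : PixelImage) u)) ∧
      ∀ R : Plane ≃ₗᵢ[ℝ] Plane, (∀ w, ∃ w', R (pixel w) = pixel w') →
        ∀ w w', R (pixel w) = pixel w' → κ w = κ w' := by
  let _ : MeasurableSpace PixelImage := borel _
  have : BorelSpace PixelImage := ⟨rfl⟩
  obtain ⟨T, hT, -, hsymm, hU⟩ := exists_mean_meshProj hX hind measurable_pixelTriangle
  have hinner : ∀ (u : ℤ × ℤ) (f : PixelImage), inner ℝ (lp.single 2 u (1 : ℝ) : PixelImage) f = f u := by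
    intro u f
    rw [lp.inner_single_left]
    simp
  have htrans : ∀ u v, T (lp.single 2 u (1 : ℝ)) v = T (lp.single 2 0 (1 : ℝ)) (v - u) := by
    intro u v
    have h := hU (permPixels (Equiv.addLeft u)) (AffineIsometryEquiv.constVAdd ℝ Plane (pixel u))
      (permPixels_pixelTriangle fun w => by simp [pixel_add]) (lp.single 2 0 (1 : ℝ))
    rw [permPixels_single] at h
    simp only [Equiv.coe_addLeft, add_zero] at h
    rw [h, permPixels_apply]
    simp [sub_eq_add_neg, add_comm]
  refine ⟨fun w => T (lp.single 2 0 (1 : ℝ)) w, fun x => ⟨?_, fun u => ?_⟩, fun R hR w w' hw => ?_⟩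
  · simp only [pixelReconstruction_eq]
    exact (hT x).1
  · simp only [pixelReconstruction_eq]
    rw [← (hT x).2, ← hinner u (T x), ← hsymm]
    have h := lp.hasSum_inner (𝕜 := ℝ) (T (lp.single 2 u (1 : ℝ))) x
    -- Self-adjointness exchanges `u` and `v`, which turns `u - v` into the argument that the inner
    -- product needs.
    have hfun : (fun v => x v * T (lp.single 2 0 (1 : ℝ)) (u - v)) =
        fun v => inner ℝ (T (lp.single 2 u (1 : ℝ)) v) (x v) := by
      ext1 v
      rw [← htrans v u, ← hinner u, ← hsymm, real_inner_comm, hinner]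
      simp
    rw [hfun]
    exact h
  · obtain ⟨e, he⟩ := exists_perm_pixels R hR
    have h0 : e 0 = 0 := by
      apply pixel_injective
      rw [← he]
      have : pixel 0 = 0 := by
        ext i
        fin_cases i <;> simp [pixel]
      rw [this, map_zero]
    have h := hU (permPixels e) R.toAffineIsometryEquiv (permPixels_pixelTriangle he)
      (lp.single 2 0 (1 : ℝ))
    rw [permPixels_single, h0] at h
    have hw' : e w = w' := pixel_injective (by rw [← he, hw])
    simp only
    conv_rhs => rw [h, ← hw', permPixels_apply, e.symm_apply_apply]

end Discrete

/-! ### Isometries and disc averages on square integrable images -/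

section Images

/-- Moving an image by an isometry of the plane. -/
noncomputable def moveImage (g : Plane ≃ᵃⁱ[ℝ] Plane) : Image ≃ₗᵢ[ℝ] Image :=
  LinearIsometryEquiv.ofSurjective
    (Lp.compMeasurePreservingₗᵢ ℝ g.symm (measurePreserving_affineIsometryEquiv g.symm)) (by
      intro f
      refine ⟨Lp.compMeasurePreserving g (measurePreserving_affineIsometryEquiv g) f, ?_⟩
      have h : (g ∘ g.symm : Plane → Plane) = id := by
        ext1 p
        simp
      have h2 := Lp.compMeasurePreserving_comp_apply f (measurePreserving_affineIsometryEquiv g)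
        (measurePreserving_affineIsometryEquiv g.symm)
      simp only [h] at h2
      rw [Lp.compMeasurePreserving_id_apply] at h2
      exact h2.symm)

theorem coeFn_moveImage (g : Plane ≃ᵃⁱ[ℝ] Plane) (f : Image) :
    (moveImage g f : Plane → ℝ) =ᵐ[volume] f ∘ g.symm :=
  Lp.coeFn_compMeasurePreserving f (measurePreserving_affineIsometryEquiv g.symm)

theorem moveImage_symm (g : Plane ≃ᵃⁱ[ℝ] Plane) : (moveImage g).symm = moveImage g.symm := by
  ext1 f
  rw [LinearIsometryEquiv.symm_apply_eq]
  refine Lp.ext ?_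
  have h1 := (measurePreserving_affineIsometryEquiv g.symm).quasiMeasurePreserving.ae_eq_comp
    (coeFn_moveImage g.symm f)
  filter_upwards [coeFn_moveImage g (moveImage g.symm f), h1] with p hp hp'
  rw [hp]
  simp only [Function.comp_apply] at hp' ⊢
  rw [hp']
  simp

/-- The indicator function of a closed disc. -/
noncomputable def disc (z : Plane) (r : ℝ) : Image :=
  indicatorConstLp 2 (Metric.isClosed_closedBall (x := z) (ε := r)).measurableSet
    measure_closedBall_lt_top.ne (1 : ℝ)

theorem moveImage_indicatorConstLp (g : Plane ≃ᵃⁱ[ℝ] Plane) {s t : Set Plane}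
    (hs : MeasurableSet s) (hs' : volume s ≠ ∞) (ht : MeasurableSet t) (ht' : volume t ≠ ∞)
    (h : g.symm ⁻¹' s = t) :
    moveImage g (indicatorConstLp 2 hs hs' (1 : ℝ)) = indicatorConstLp 2 ht ht' (1 : ℝ) := by
  subst h
  rfl

theorem moveImage_disc (g : Plane ≃ᵃⁱ[ℝ] Plane) (z : Plane) (r : ℝ) :
    moveImage g (disc z r) = disc (g z) r := by
  refine moveImage_indicatorConstLp g _ _ _ _ ?_
  ext p
  simp only [Set.mem_preimage, Metric.mem_closedBall]
  rw [← g.dist_map, g.apply_symm_apply]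

theorem inner_disc (z : Plane) (r : ℝ) (f : Image) :
    inner ℝ (disc z r) f = ∫ p in Metric.closedBall z r, f p :=
  L2.inner_indicatorConstLp_one _ _ f

/-- The area of a disc of radius `r`. -/
noncomputable def discArea (r : ℝ) : ℝ := volume.real (Metric.closedBall (0 : Plane) r)

theorem discArea_eq {r : ℝ} (hr : 0 ≤ r) : discArea r = Real.pi * r ^ 2 := by
  rw [discArea, Measure.real, EuclideanSpace.volume_closedBall_fin_two, ENNReal.toReal_mul,
    ENNReal.toReal_pow, ENNReal.toReal_ofReal hr, ENNReal.toReal_ofReal Real.pi_pos.le, mul_comm]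

theorem average_eq_inner_disc (z : Plane) (r : ℝ) (f : Image) :
    ⨍ p in Metric.closedBall z r, f p = (discArea r)⁻¹ * inner ℝ (disc z r) f := by
  rw [setAverage_eq, inner_disc, smul_eq_mul, discArea, Measure.real, Measure.real,
    Measure.addHaar_closedBall_center]

/-- The Lebesgue differentiation theorem for square integrable functions. -/
theorem ae_tendsto_inner_disc {r : ℕ → ℝ} (hr : Tendsto r atTop (𝓝[>] 0)) (f : Image) :
    ∀ᵐ z, Tendsto (fun n => (discArea (r n))⁻¹ * inner ℝ (disc z (r n)) f) atTop (𝓝 (f z)) := by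
  have h := IsUnifLocDoublingMeasure.ae_tendsto_average (volume : Measure Plane)
    ((Lp.memLp f).locallyIntegrable one_le_two) 1
  filter_upwards [h] with z hz
  simp only [← average_eq_inner_disc]
  refine hz (fun _ => z) r hr ?_
  filter_upwards [hr.eventually self_mem_nhdsWithin] with n hn
  have : 0 < r n := hn
  simp [this.le]

end Images

/-! ### From bounded approximate kernels to a radial convolution kernel -/

section Kernel

/-- A bounded sequence in a Hilbert space has a weak cluster point. -/
theorem exists_weak_clusterPt {H : Type*} [NormedAddCommGroup H] [InnerProductSpace ℝ H]
    [CompleteSpace H] {v : ℕ → H} {M : ℝ} (hv : ∀ n, ‖v n‖ ≤ M) :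
    ∃ k : H, ∀ (f : H) (a : ℝ), Tendsto (fun n => inner ℝ (v n) f) atTop (𝓝 a) →
      inner ℝ k f = a := by
  let φ : ℕ → WeakDual ℝ H := fun n =>
    StrongDual.toWeakDual (InnerProductSpace.toDual ℝ H (v n))
  -- Banach-Alaoglu, carried to `H` by the Riesz isomorphism. A cluster point suffices: wherever the
  -- pairings converge, its pairing must be the limit.
  obtain ⟨ψ, -, hψ⟩ := (WeakDual.isCompact_closedBall (𝕜 := ℝ) (0 : StrongDual ℝ H) M).exists_mapClusterPt
    (f := atTop) (u := φ) (by
      rw [le_principal_iff, mem_map]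
      refine univ_mem' fun n => ?_
      simpa [φ] using hv n)
  refine ⟨(InnerProductSpace.toDual ℝ H).symm (WeakDual.toStrongDual ψ), fun f a ha => ?_⟩
  rw [InnerProductSpace.toDual_symm_apply]
  have h1 : MapClusterPt (ψ f) atTop ((fun ψ : WeakDual ℝ H => ψ f) ∘ φ) :=
    hψ.continuousAt_comp (WeakDual.eval_continuous f).continuousAt
  have h2 : Tendsto ((fun ψ : WeakDual ℝ H => ψ f) ∘ φ) atTop (𝓝 a) := ha
  have h3 : ClusterPt (ψ f) (𝓝 a) := ClusterPt.mono h1 h2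
  have : (𝓝 (ψ f) ⊓ 𝓝 a).NeBot := h3
  exact eq_of_nhds_neBot this

/-- A bounded operator on the square integrable functions that commutes with the isometries of the
plane and is bounded on normalized indicator functions of small discs is the convolution with a
square integrable radial function. -/
theorem exists_radial_kernel {T : Image →L[ℝ] Image}
    (hsymm : ∀ x y, inner ℝ (T x) y = inner ℝ x (T y))
    (hcomm : ∀ (g : Plane ≃ᵃⁱ[ℝ] Plane) x, T (moveImage g x) = moveImage g (T x))
    {r : ℕ → ℝ} (hr : Tendsto r atTop (𝓝[>] 0)) {M : ℝ}
    (hM : ∀ n, ‖T ((discArea (r n))⁻¹ • disc 0 (r n))‖ ≤ M) :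
    ∃ κ : Plane → ℝ, (∀ u v, ‖u‖ = ‖v‖ → κ u = κ v) ∧
      ∀ x : Image, ConvolutionExists (x : Plane → ℝ) κ (ContinuousLinearMap.lsmul ℝ ℝ) volume ∧
        (T x : Plane → ℝ) =ᵐ[volume]
          convolution (x : Plane → ℝ) κ (ContinuousLinearMap.lsmul ℝ ℝ) volume := by
  obtain ⟨k, hk⟩ := exists_weak_clusterPt hM
  -- the limit is invariant under linear isometries
  have hkinv : ∀ g : Plane ≃ₗᵢ[ℝ] Plane, moveImage g.toAffineIsometryEquiv k = k := by
    intro g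
    set U := moveImage g.toAffineIsometryEquiv with hU
    have h1 : ∀ f, inner ℝ k (U f) = inner ℝ k f := by
      intro f
      have h2 : inner ℝ k (U f - f) = 0 := by
        refine hk _ _ (tendsto_const_nhds.congr fun n => ?_)
        set d : Image := (discArea (r n))⁻¹ • disc 0 (r n)
        have h3 : U d = d := by
          simp only [d, map_smul, hU, moveImage_disc]
          simp
        have h4 : inner ℝ (T d) (U f) = inner ℝ (T d) f := by
          conv_lhs => rw [← h3, hU, hcomm, ← hU, U.inner_map_map]
        rw [inner_sub_right, h4, sub_self]
      rw [inner_sub_right] at h2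
      linarith
    refine ext_inner_right ℝ fun f => ?_
    rw [← U.apply_symm_apply f, U.inner_map_map, h1]
  -- The vector `k` is a class modulo null sets, invariant only as such. Its disc averages are
  -- defined at every point, and they agree for every `n` at points of equal norm; so this
  -- representative is radial everywhere, even where the limit does not exist.
  let κ : Plane → ℝ := fun z =>
    limUnder atTop fun n => (discArea (r n))⁻¹ * inner ℝ (disc z (r n)) k
  have hκ : κ =ᵐ[volume] k := by
    filter_upwards [ae_tendsto_inner_disc hr k] with z hz
    exact hz.limUnder_eq
  have hrad : ∀ u v, ‖u‖ = ‖v‖ → κ u = κ v := by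
    intro u v huv
    -- For `u` and `v` of equal norm, this reflection exchanges them.
    set g : Plane ≃ₗᵢ[ℝ] Plane := (ℝ ∙ (u - v))ᗮ.reflection
    have hg : g u = v := Submodule.reflection_sub huv
    have h1 : ∀ n, inner ℝ (disc v (r n)) k = inner ℝ (disc u (r n)) k := by
      intro n
      have h2 : disc v (r n) = moveImage g.toAffineIsometryEquiv (disc u (r n)) := by
        rw [moveImage_disc]
        simp [hg]
      conv_lhs => rw [h2, ← hkinv g, LinearIsometryEquiv.inner_map_map]
    simp only [κ, h1]
  have hκmem : MemLp κ 2 volume := (memLp_congr_ae hκ).2 (Lp.memLp k)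
  refine ⟨κ, hrad, fun x => ⟨fun u => ?_, ?_⟩⟩
  · have h1 : MemLp (fun t => κ (u - t)) 2 volume :=
      hκmem.comp_measurePreserving (Measure.measurePreserving_sub_left volume u)
    exact (Lp.memLp x).integrable_mul h1
  · filter_upwards [ae_tendsto_inner_disc hr (T x)] with u hu
    set τ := AffineIsometryEquiv.constVAdd ℝ Plane u
    have hTs : T ((moveImage τ).symm x) = (moveImage τ).symm (T x) := by
      rw [moveImage_symm, hcomm]
    -- Self-adjointness and translation invariance turn the pairings that define `k` into averages
    -- of `T x` over discs centred at `u`, which converge to `T x u`.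
    have h1 : inner ℝ k ((moveImage τ).symm x) = T x u := by
      refine hk _ _ (hu.congr fun n => ?_)
      have h2 : disc u (r n) = moveImage τ (disc 0 (r n)) := by
        rw [moveImage_disc]
        simp [τ]
      have h5 : inner ℝ (disc u (r n)) (T x) =
          inner ℝ (disc 0 (r n)) ((moveImage τ).symm (T x)) := by
        rw [h2, ← (moveImage τ).inner_map_map (disc 0 (r n)),
          LinearIsometryEquiv.apply_symm_apply]
      rw [h5, hsymm, hTs, inner_smul_left]
      simp
    rw [← h1, convolution_def, L2.inner_def]
    have h3 : ∀ t, κ (u - t) = κ (t - u) := fun t => hrad _ _ (norm_sub_rev _ _)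
    simp only [h3]
    rw [← integral_add_right_eq_self (fun t => (ContinuousLinearMap.lsmul ℝ ℝ (x t)) (κ (t - u))) u]
    refine integral_congr_ae ?_
    have h4 := coeFn_moveImage τ.symm x
    rw [← moveImage_symm] at h4
    filter_upwards [h4, hκ] with t ht ht'
    rw [ht, ← ht']
    simp [τ, add_comm]

end Kernel

/-! ### The trace bound on a grid of discs -/

section TriangleImages

/-- The indicator function of a triangle. -/
noncomputable def triangleImage (t : Finset Plane) : Image :=
  indicatorConstLp 2 (isCompact_triangle t).measurableSet
    (isCompact_triangle t).measure_lt_top.ne (1 : ℝ)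

theorem reconstruction_eq {L : ℕ} (S : Fin L → Set Plane) (x : Image) :
    reconstruction S x = meshProj triangleImage S x :=
  pinvTranspose_transposeApply _ _

open Classical in
theorem moveImage_triangleImage (g : Plane ≃ᵃⁱ[ℝ] Plane) (t : Finset Plane) :
    moveImage g (triangleImage t) = triangleImage (t.image g) := by
  refine moveImage_indicatorConstLp g _ _ _ _ ?_
  rw [triangle_image]
  exact (congrFun (Set.image_eq_preimage_of_inverse g.symm_apply_apply g.apply_symm_apply) _).symm

instance : SecondCountableTopology Image := by
  have : Fact ((2 : ℝ≥0∞) ≠ ∞) := ⟨by simp⟩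
  exact Lp.SecondCountableTopology

open Classical in
theorem measurable_triangleImage [MeasurableSpace Image] [BorelSpace Image] :
    Measurable fun a : Fin 3 → Plane => triangleImage (Finset.univ.image a) := by
  refine measurable_of_inner fun y => ?_
  have h1 : MeasurableSet {q : (Fin 3 → Plane) × Plane | q.2 ∈ triangle (Finset.univ.image q.1)} :=
    isClosed_mem_triangle.measurableSet
  have h2 : StronglyMeasurable fun q : (Fin 3 → Plane) × Plane =>
      Set.indicator {q : (Fin 3 → Plane) × Plane | q.2 ∈ triangle (Finset.univ.image q.1)}
        (fun q => y q.2) q :=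
    ((Lp.stronglyMeasurable y).comp_measurable measurable_snd).indicator h1
  have h3 := (h2.integral_prod_right' (ν := volume)).measurable
  convert h3 using 1
  ext1 a
  rw [real_inner_comm, triangleImage, L2.inner_indicatorConstLp_one,
    ← integral_indicator (isCompact_triangle _).measurableSet]
  rfl

theorem inner_disc_triangleImage {z : Plane} {r : ℝ} {t : Finset Plane}
    (h : Disjoint (Metric.closedBall z r) (triangle t)) : inner ℝ (disc z r) (triangleImage t) = 0 := by
  rw [disc, triangleImage, L2.inner_indicatorConstLp_indicatorConstLp _ _
    measure_closedBall_lt_top.ne (isCompact_triangle t).measure_lt_top.ne, h.inter_eq]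
  simp

theorem inner_disc_disc (z w : Plane) (r : ℝ) : inner ℝ (disc z r) (disc w r) =
    volume.real (Metric.closedBall z r ∩ Metric.closedBall w r) := by
  rw [disc, disc, L2.inner_indicatorConstLp_indicatorConstLp _ _ measure_closedBall_lt_top.ne
    measure_closedBall_lt_top.ne]
  simp

/-- The radius of the discs in the square grid of mesh size `1 / (n + 1)`. -/
noncomputable def gridRadius (n : ℕ) : ℝ := 1 / (4 * (n + 1))

theorem gridRadius_pos (n : ℕ) : 0 < gridRadius n := by
  unfold gridRadius
  positivity

theorem tendsto_gridRadius : Tendsto gridRadius atTop (𝓝[>] 0) := by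
  refine tendsto_nhdsWithin_iff.2 ⟨?_, Eventually.of_forall gridRadius_pos⟩
  have h := (tendsto_one_div_add_atTop_nhds_zero_nat (𝕜 := ℝ)).const_mul (1 / 4)
  rw [mul_zero] at h
  refine h.congr fun n => ?_
  unfold gridRadius
  field_simp

/-- The points of the square grid of mesh size `1 / (n + 1)` in the unit square. -/
noncomputable def gridPoint (n : ℕ) (k : Fin (n + 1) × Fin (n + 1)) : Plane :=
  ((n : ℝ) + 1)⁻¹ • pixel ((k.1 : ℕ), (k.2 : ℕ))

theorem closedBall_gridPoint_subset (n : ℕ) (k : Fin (n + 1) × Fin (n + 1)) :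
    Metric.closedBall (gridPoint n k) (gridRadius n) ⊆ Metric.closedBall 0 2 := by
  refine Metric.closedBall_subset_closedBall' ?_
  have hn : (0 : ℝ) < (n : ℝ) + 1 := by positivity
  have h1 : gridRadius n ≤ 1 / 4 := by
    unfold gridRadius
    refine one_div_le_one_div_of_le (by norm_num) ?_
    have : (0 : ℝ) ≤ n := n.cast_nonneg
    linarith
  have hk : ∀ i : Fin (n + 1), ((i : ℕ) : ℝ) ≤ (n : ℝ) + 1 := fun i => by
    exact_mod_cast i.2.le
  have h2 : ‖pixel ((k.1 : ℕ), (k.2 : ℕ))‖ ≤ 3 / 2 * ((n : ℝ) + 1) := by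
    rw [EuclideanSpace.norm_eq]
    refine Real.sqrt_le_iff.2 ⟨by positivity, ?_⟩
    simp only [Fin.sum_univ_two, pixel, Real.norm_eq_abs, sq_abs]
    have h3 := pow_le_pow_left₀ (Nat.cast_nonneg _) (hk k.1) 2
    have h4 := pow_le_pow_left₀ (Nat.cast_nonneg _) (hk k.2) 2
    simp
    nlinarith
  rw [dist_zero_right, gridPoint, norm_smul, norm_inv, Real.norm_of_nonneg hn.le]
  have h3 : ((n : ℝ) + 1)⁻¹ * ‖pixel ((k.1 : ℕ), (k.2 : ℕ))‖ ≤ 3 / 2 := by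
    rw [inv_mul_le_iff₀ hn]
    linarith
  linarith

theorem one_le_norm_pixel_sub {u v : ℤ × ℤ} (h : u ≠ v) : 1 ≤ ‖pixel u - pixel v‖ := by
  have key : ∀ (i : Fin 2) (a b : ℤ), a ≠ b → (pixel u - pixel v) i = (a : ℝ) - b →
      1 ≤ ‖pixel u - pixel v‖ := by
    intro i a b hab hi
    have h1 := abs_apply_le_norm (pixel u - pixel v) i
    rw [hi] at h1
    refine le_trans ?_ h1
    exact_mod_cast Int.one_le_abs (sub_ne_zero.2 hab)
  by_cases h1 : u.1 = v.1
  · exact key 1 u.2 v.2 (fun h2 => h (Prod.ext h1 h2)) (by simp [pixel])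
  · exact key 0 u.1 v.1 h1 (by simp [pixel])

theorem disjoint_closedBall_gridPoint (n : ℕ) {k j : Fin (n + 1) × Fin (n + 1)} (h : k ≠ j) :
    Disjoint (Metric.closedBall (gridPoint n k) (gridRadius n))
      (Metric.closedBall (gridPoint n j) (gridRadius n)) := by
  refine Metric.closedBall_disjoint_closedBall ?_
  have hn : (0 : ℝ) < (n : ℝ) + 1 := by positivity
  have hne : (((k.1 : ℕ) : ℤ), ((k.2 : ℕ) : ℤ)) ≠ (((j.1 : ℕ) : ℤ), ((j.2 : ℕ) : ℤ)) := by
    intro h'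
    simp only [Prod.mk.injEq, Nat.cast_inj] at h'
    exact h (Prod.ext (Fin.ext h'.1) (Fin.ext h'.2))
  have h1 := one_le_norm_pixel_sub hne
  rw [dist_eq_norm, gridPoint, gridPoint, ← smul_sub, norm_smul, norm_inv,
    Real.norm_of_nonneg hn.le]
  have h2 : gridRadius n + gridRadius n < ((n : ℝ) + 1)⁻¹ := by
    have : gridRadius n + gridRadius n = 1 / 2 * ((n : ℝ) + 1)⁻¹ := by
      unfold gridRadius
      field_simp
      norm_num
    rw [this]
    have : 0 < ((n : ℝ) + 1)⁻¹ := inv_pos.2 hn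
    linarith
  exact h2.trans_le (le_mul_of_one_le_right (inv_pos.2 hn).le h1)

theorem discArea_gridRadius_pos (n : ℕ) : 0 < discArea (gridRadius n) := by
  rw [discArea_eq (gridRadius_pos n).le]
  have := gridRadius_pos n
  positivity

theorem orthonormal_grid (n : ℕ) : Orthonormal ℝ fun k : Fin (n + 1) × Fin (n + 1) =>
    (√(discArea (gridRadius n)))⁻¹ • disc (gridPoint n k) (gridRadius n) := by
  rw [orthonormal_iff_ite]
  intro k j
  rw [inner_smul_left, inner_smul_right, inner_disc_disc]
  split_ifs with h
  · subst h
    have hv := discArea_gridRadius_pos n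
    rw [Set.inter_self, Measure.real, Measure.addHaar_closedBall_center]
    change (√(discArea (gridRadius n)))⁻¹ * ((√(discArea (gridRadius n)))⁻¹ *
      discArea (gridRadius n)) = 1
    rw [← mul_assoc, ← mul_inv, Real.mul_self_sqrt hv.le, inv_mul_cancel₀ hv.ne']
  · rw [(disjoint_closedBall_gridPoint n h).inter_eq]
    simp

/-- The trace of the projection on functions supported near the origin is at most the number of
triangles near the origin. -/
theorem sum_norm_sq_meshProj_le {L : ℕ} (S : Fin L → Set Plane) {κ : Type*} [Fintype κ]
    {e : κ → Image} (he : Orthonormal ℝ e)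
    (hes : ∀ k t, Disjoint (Metric.closedBall 0 2) (triangle t) → inner ℝ (e k) (triangleImage t) = 0) :
    ENNReal.ofReal (∑ k, ‖meshProj triangleImage S (e k)‖ ^ 2) ≤
      ∑ l, (((centralTriangles (S l)).encard : ℕ∞) : ℝ≥0∞) := by
  classical
  by_cases hfin : ∀ l, (centralTriangles (S l)).Finite
  · let s : Finset (Columns S) := Finset.univ.sigma fun l =>
      (hfin l).toFinset.subtype (· ∈ delaunay (S l))
    have h1 := sum_norm_sq_spanProj_le he (fun p : Columns S => triangleImage p.2.1) s (by
      rintro ⟨l, t, ht⟩ hp k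
      refine hes k t ?_
      rw [Set.disjoint_iff_inter_eq_empty, ← Set.not_nonempty_iff_eq_empty]
      rintro ⟨q, hq1, hq2⟩
      refine hp (Finset.mem_sigma.2 ⟨Finset.mem_univ l, ?_⟩)
      rw [Finset.mem_subtype, Set.Finite.mem_toFinset]
      exact ⟨ht, q, hq2, hq1⟩)
    calc ENNReal.ofReal (∑ k, ‖meshProj triangleImage S (e k)‖ ^ 2)
        ≤ ENNReal.ofReal s.card := ENNReal.ofReal_le_ofReal h1
      _ = (s.card : ℝ≥0∞) := ENNReal.ofReal_natCast _
      _ ≤ ((∑ l, (hfin l).toFinset.card : ℕ) : ℝ≥0∞) := by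
          rw [Finset.card_sigma]
          refine Nat.cast_le.2 (Finset.sum_le_sum fun l _ => ?_)
          rw [Finset.card_subtype]
          exact Finset.card_filter_le _ _
      _ = _ := by
          rw [Nat.cast_sum]
          refine Finset.sum_congr rfl fun l _ => ?_
          rw [(hfin l).encard_eq_coe_toFinset_card]
          simp
  -- With infinitely many triangles near the origin, the right-hand side is `⊤`.
  · push Not at hfin
    obtain ⟨l, hl⟩ := hfin
    refine le_trans ?_ (Finset.single_le_sum (fun _ _ => zero_le) (Finset.mem_univ l))
    rw [Set.Infinite.encard_eq hl]
    simp

/-- An operator that commutes with isometries and has small trace on a grid of discs is small on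
each of them. -/
theorem norm_apply_disc_le {T : Image →L[ℝ] Image}
    (hcomm : ∀ (g : Plane ≃ᵃⁱ[ℝ] Plane) x, T (moveImage g x) = moveImage g (T x))
    (hTsq : ∀ x, ‖T x‖ ^ 2 ≤ inner ℝ x (T x)) {n : ℕ} {C : ℝ}
    (htrace : ∑ k : Fin (n + 1) × Fin (n + 1),
      inner ℝ ((√(discArea (gridRadius n)))⁻¹ • disc (gridPoint n k) (gridRadius n))
        (T ((√(discArea (gridRadius n)))⁻¹ • disc (gridPoint n k) (gridRadius n))) ≤ C) :
    ‖T ((discArea (gridRadius n))⁻¹ • disc 0 (gridRadius n))‖ ≤ √(16 * C / Real.pi) := by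
  set v := discArea (gridRadius n) with hv
  have hv0 : 0 < v := discArea_gridRadius_pos n
  set f := disc 0 (gridRadius n)
  have h1 : ∀ k, inner ℝ ((√v)⁻¹ • disc (gridPoint n k) (gridRadius n))
      (T ((√v)⁻¹ • disc (gridPoint n k) (gridRadius n))) = v⁻¹ * inner ℝ f (T f) := by
    intro k
    have h2 : disc (gridPoint n k) (gridRadius n) =
        moveImage (AffineIsometryEquiv.constVAdd ℝ Plane (gridPoint n k)) f := by
      rw [moveImage_disc]
      simp
    rw [map_smul, inner_smul_left, inner_smul_right, h2, hcomm, LinearIsometryEquiv.inner_map_map,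
      ← mul_assoc]
    congr 1
    change (√v)⁻¹ * (√v)⁻¹ = v⁻¹
    rw [← mul_inv, Real.mul_self_sqrt hv0.le]
  have h3 := htrace
  rw [Finset.sum_congr rfl fun k _ => h1 k, Finset.sum_const, Finset.card_univ, nsmul_eq_mul,
    Fintype.card_prod, Fintype.card_fin] at h3
  have hn : (0 : ℝ) < (n : ℝ) + 1 := by positivity
  -- The discs cover a fraction of the unit square, `π / 16` in total area, independent of `n`; this
  -- is why the final bound does not depend on `n`.
  have hv1 : v * (16 * ((n : ℝ) + 1) ^ 2) = Real.pi := by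
    rw [hv, discArea_eq (gridRadius_pos n).le, gridRadius]
    field_simp
    norm_num
  refine Real.le_sqrt_of_sq_le ?_
  rw [map_smul, norm_smul, mul_pow, norm_inv, Real.norm_of_nonneg hv0.le]
  calc (v⁻¹) ^ 2 * ‖T f‖ ^ 2 ≤ (v⁻¹) ^ 2 * inner ℝ f (T f) := by
        gcongr
        exact hTsq f
    _ = 16 / Real.pi * (((n + 1) * (n + 1) : ℕ) * (v⁻¹ * inner ℝ f (T f))) := by
        rw [← hv1]
        push_cast
        field_simp
    _ ≤ 16 / Real.pi * C := by gcongr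
    _ = 16 * C / Real.pi := by ring

variable {Ω : Type*} [MeasurableSpace Ω] {P : Measure Ω} [IsProbabilityMeasure P] {L : ℕ}
  {ρ : ℝ≥0} {X : Fin L → Ω → Set Plane}

/-- The expected number of triangles near the origin bounds the trace of `T` on every grid of discs.
This is the uniform bound from which `exists_radial_kernel` produces the kernel. -/
theorem exists_image_kernel (hρ : 0 < ρ) (hX : ∀ l, IsPoissonProcess P ρ (X l))
    (hind : IndependentProcesses P X) :
    ∃ κ : Plane → ℝ,
      (∀ x : Image,
        Integrable (fun ω => reconstruction (fun l => X l ω) x) P ∧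
        ConvolutionExists (x : Plane → ℝ) κ (ContinuousLinearMap.lsmul ℝ ℝ) volume ∧
        ((∫ ω, reconstruction (fun l => X l ω) x ∂P : Image) : Plane → ℝ)
          =ᵐ[volume] convolution (x : Plane → ℝ) κ (ContinuousLinearMap.lsmul ℝ ℝ) volume) ∧
      ∀ u v : Plane, ‖u‖ = ‖v‖ → κ u = κ v := by
  let _ : MeasurableSpace Image := borel _
  have : BorelSpace Image := ⟨rfl⟩
  obtain ⟨T, hT, hTi, hsymm, hU⟩ := exists_mean_meshProj hX hind measurable_triangleImage
  have hcomm : ∀ (g : Plane ≃ᵃⁱ[ℝ] Plane) x, T (moveImage g x) = moveImage g (T x) :=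
    fun g => hU (moveImage g) g (moveImage_triangleImage g)
  have hTT : ∀ x, inner ℝ x (T x) = ∫ ω, ‖meshProj triangleImage (fun l => X l ω) x‖ ^ 2 ∂P := by
    intro x
    rw [hTi]
    exact integral_congr_ae (ae_of_all _ fun ω => inner_spanProj_self _ x)
  have hint : ∀ x, Integrable (fun ω => ‖meshProj triangleImage (fun l => X l ω) x‖ ^ 2) P := by
    intro x
    refine ((hT x).1.const_inner x).congr (ae_of_all _ fun ω => inner_spanProj_self _ x)
  have hpos : ∀ x, 0 ≤ inner ℝ x (T x) := fun x => by
    rw [hTT]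
    exact integral_nonneg fun ω => sq_nonneg _
  have hle : ∀ x, inner ℝ x (T x) ≤ ‖x‖ ^ 2 := fun x => by
    rw [hTT]
    calc _ ≤ ∫ _, ‖x‖ ^ 2 ∂P := integral_mono (hint x) (integrable_const _) fun ω =>
          pow_le_pow_left₀ (norm_nonneg _) (norm_spanProj_le _ x) 2
      _ = _ := by simp
  -- This is `T² ≤ T`: expand `0 ≤ ⟨x - T x, T (x - T x)⟩` and use `⟨T x, T (T x)⟩ ≤ ‖T x‖ ^ 2`.
  have hTsq : ∀ x, ‖T x‖ ^ 2 ≤ inner ℝ x (T x) := by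
    intro x
    have h1 := hpos (x - T x)
    have h2 := hle (T x)
    rw [map_sub, inner_sub_left, inner_sub_right, inner_sub_right, ← hsymm x (T x),
      real_inner_self_eq_norm_sq] at h1
    linarith
  choose F hFm hF hFint using fun l => (hX l).exists_bound_centralTriangles hρ
  set C : ℝ≥0∞ := ∫⁻ ω, ∑ l, F l ω ∂P
  have hC : C ≠ ∞ := by
    simp only [C]
    rw [lintegral_finsetSum _ fun l _ => hFm l]
    exact ENNReal.sum_ne_top.2 fun l _ => hFint l
  have htrace : ∀ n, ∑ k : Fin (n + 1) × Fin (n + 1),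
      inner ℝ ((√(discArea (gridRadius n)))⁻¹ • disc (gridPoint n k) (gridRadius n))
        (T ((√(discArea (gridRadius n)))⁻¹ • disc (gridPoint n k) (gridRadius n))) ≤ C.toReal := by
    intro n
    simp only [hTT]
    rw [← integral_finsetSum _ fun k _ => hint _]
    refine (ENNReal.ofReal_le_iff_le_toReal hC).1 ?_
    rw [ofReal_integral_eq_lintegral_ofReal (integrable_finsetSum _ fun k _ => hint _)
      (ae_of_all _ fun ω => Finset.sum_nonneg fun k _ => sq_nonneg _)]
    refine lintegral_mono fun ω => ?_
    refine (sum_norm_sq_meshProj_le (fun l => X l ω) (orthonormal_grid n) ?_).trans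
      (Finset.sum_le_sum fun l _ => hF l ω)
    intro k t ht
    rw [inner_smul_left, inner_disc_triangleImage (ht.mono_left (closedBall_gridPoint_subset n k)),
      mul_zero]
  have hM := fun n => norm_apply_disc_le hcomm hTsq (htrace n)
  obtain ⟨κ, hrad, hκ⟩ := exists_radial_kernel hsymm hcomm tendsto_gridRadius hM
  refine ⟨κ, fun x => ⟨?_, (hκ x).1, ?_⟩, hrad⟩
  · simp only [reconstruction_eq]
    exact (hT x).1
  · simp only [reconstruction_eq]
    rw [← (hT x).2]
    exact (hκ x).2

end TriangleImages

end RandomMesh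

theorem proposition1 {Ω : Type*} [MeasurableSpace Ω] (P : Measure Ω) [IsProbabilityMeasure P]
    (L : ℕ) (ρ : ℝ≥0) (hρ : 0 < ρ) (X : Fin L → Ω → Set RandomMesh.Plane)
    (hX : ∀ l, RandomMesh.IsPoissonProcess P ρ (X l))
    (hind : RandomMesh.IndependentProcesses P X) :
    -- images on the plane
    (∃ κ : RandomMesh.Plane → ℝ,
      (∀ x : RandomMesh.Image,
        Integrable (fun ω => RandomMesh.reconstruction (fun l => X l ω) x) P ∧
        ConvolutionExists (x : RandomMesh.Plane → ℝ) κ (ContinuousLinearMap.lsmul ℝ ℝ) volume ∧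
        ((∫ ω, RandomMesh.reconstruction (fun l => X l ω) x ∂P : RandomMesh.Image) :
            RandomMesh.Plane → ℝ)
          =ᵐ[volume] convolution (x : RandomMesh.Plane → ℝ) κ
            (ContinuousLinearMap.lsmul ℝ ℝ) volume) ∧
      ∀ u v : RandomMesh.Plane, ‖u‖ = ‖v‖ → κ u = κ v) ∧
    -- images on the grid of pixels
    (∃ κ : ℤ × ℤ → ℝ,
      (∀ x : RandomMesh.PixelImage,
        Integrable (fun ω => RandomMesh.pixelReconstruction (fun l => X l ω) x) P ∧
        ∀ u : ℤ × ℤ, HasSum (fun v => x v * κ (u - v))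
          ((∫ ω, RandomMesh.pixelReconstruction (fun l => X l ω) x ∂P : RandomMesh.PixelImage) u)) ∧
      ∀ R : RandomMesh.Plane ≃ₗᵢ[ℝ] RandomMesh.Plane,
        (∀ w, ∃ w', R (RandomMesh.pixel w) = RandomMesh.pixel w') →
        ∀ w w', R (RandomMesh.pixel w) = RandomMesh.pixel w' → κ w = κ w') := by
  exact ⟨RandomMesh.exists_image_kernel hρ hX hind, RandomMesh.exists_pixel_kernel hX hind⟩
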